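/- Let $V$ be a finite set, let $s,t\in V$ be distinct, and let $c$ be nonnegative costs satisfying the triangle inequality on the edge set $E$ of the complete graph on $V$. For $S\subseteq V$ let $\delta(S)$ be the set of edges with exactly one end in $S$, write $\delta(v)=\delta(\{v\})$, and for $x\in\mathbb{R}^E$ and $D\subseteq E$ put $x(D)=\sum_{e\in D}x_e$. Let (L.P.1) be the linear program of minimizing $c(x)=\sum_{e\in E}c_ex_e$ over all $x\in\mathbb{R}^E$ such that $x(\delta(s))=x(\delta(t))=1$; $x(\delta(v))=2$ for all $v\ne s,t$; $x(\delta(S))\ge 1$ whenever $|S\cap\{s,t\}|=1$; $x(\delta(S))\ge 2$ whenever $\emptyset\subsetneq S\subsetneq V$ and $|S\cap\{s,t\}|$ is even; and $0\le x_e\le 1$ for all $e\in E$. The randomized Christofides algorithm does the following. 1. Find an optimal solution $x^*$ of (L.P.1). 2. Find spanning trees $J_1,\dots,J_l$ and $\lambda_1,\dots,\lambda_l>0$ with $\sum_i\lambda_i=1$ such that $x^*=\sum_i\lambda_i\mathcal{X}^{J_i}$, where $\mathcal{X}^{J_i}$ is the incidence vector of $J_i$. Sample $J=J_i$ with probability $\lambda_i$.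 3. Let $T$ be the set of wrong degree vertices of $J$, that is, those of $s,t$ that have even degree in $J$ and those other vertices that have odd degree in $J$. Find a minimum-cost $T$-join $F$, that is, an edge set $F\subseteq E$ of minimum cost such that $T$ is the set of odd degree vertices of $(V,F)$. 4. Take an Eulerian traversal from $s$ to $t$ of the disjoint union of $J$ and $F$ (keeping duplicated edges), and shortcut it to a Hamiltonian path $P$ from $s$ to $t$, which is the output. Each of these steps can always be carried out, whatever choices were made in the previous steps; and for all choices (of the optimal solution, the decomposition, and the $T$-join, traversal and shortcut for each tree $J_i$), $$\mathbb{E}[c(P)]\le\frac{1+\sqrt5}{2}\,c(x^*)\qquad\text{and}\qquad \mathbb{E}[c(P)]\le\frac{1+\sqrt5}{2}\,\mathrm{OPT},$$ where $\mathrm{OPT}$ is the minimum cost of a Hamiltonian path from $s$ to $t$. That is, the algorithm achieves an approximation factor of $\frac{1+\sqrt5}{2}$ for the metric $s$-$t$ path TSP. -/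

import Mathlib

namespace PathTSP

variable {V : Type*} [Fintype V] [DecidableEq V]

/-- The edge set of the complete graph on `V`: all unordered pairs of distinct vertices.
Edge vectors are functions on `Sym2 V`; their values at the diagonal pairs are never used. -/
def edges (V : Type*) [Fintype V] [DecidableEq V] : Finset (Sym2 V) :=
  Finset.univ.filter fun e => ¬ e.IsDiag

/-- Nonnegative edge costs that satisfy the triangle inequality. -/
structure IsMetricCost (c : Sym2 V → ℝ) : Prop where
  nonneg : ∀ e ∈ edges V, 0 ≤ c e
  triangle : ∀ u v w : V, u ≠ v → v ≠ w → u ≠ w → c s(u, w) ≤ c s(u, v) + c s(v, w)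

/-- `δ(S)`: the edges with exactly one end in `S`. -/
def cut (S : Finset V) : Finset (Sym2 V) :=
  Finset.univ.filter fun e => ∃ u v, u ∈ S ∧ v ∉ S ∧ e = s(u, v)

/-- The feasible region of the path version of the Held-Karp relaxation (for `s ≠ t`). -/
structure LPFeasible (s t : V) (x : Sym2 V → ℝ) : Prop where
  deg_s : ∑ e ∈ cut {s}, x e = 1
  deg_t : ∑ e ∈ cut {t}, x e = 1
  deg : ∀ v, v ≠ s → v ≠ t → ∑ e ∈ cut {v}, x e = 2
  st_cut : ∀ S : Finset V, (S ∩ {s, t}).card = 1 → 1 ≤ ∑ e ∈ cut S, x e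
  even_cut : ∀ S : Finset V, S.Nonempty → S ≠ Finset.univ → Even (S ∩ {s, t}).card →
    2 ≤ ∑ e ∈ cut S, x e
  nonneg : ∀ e ∈ edges V, 0 ≤ x e
  le_one : ∀ e ∈ edges V, x e ≤ 1

/-- The objective value `c(x) = ∑ e, c e * x e`. -/
def lpCost (c x : Sym2 V → ℝ) : ℝ := ∑ e ∈ edges V, c e * x e

/-- `x` is an optimal solution of the path version of the Held-Karp relaxation. -/
def IsLPOptimal (c : Sym2 V → ℝ) (s t : V) (x : Sym2 V → ℝ) : Prop :=
  LPFeasible s t x ∧ ∀ y, LPFeasible s t y → lpCost c x ≤ lpCost c y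

/-- `J` is the edge set of a spanning tree of the complete graph on `V`. -/
def IsSpanningTree (J : Finset (Sym2 V)) : Prop :=
  J ⊆ edges V ∧ (SimpleGraph.fromEdgeSet (J : Set (Sym2 V))).IsTree

/-- A representation of `x` as a convex combination, with positive coefficients, of incidence
vectors of spanning trees. -/
structure TreeDecomposition (x : Sym2 V → ℝ) where
  size : ℕ
  tree : Fin size → Finset (Sym2 V)
  coeff : Fin size → ℝ
  isSpanningTree : ∀ i, IsSpanningTree (tree i)
  coeff_pos : ∀ i, 0 < coeff i
  sum_coeff : ∑ i, coeff i = 1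
  sum_eq : ∀ e ∈ edges V, ∑ i, coeff i * (if e ∈ tree i then 1 else 0) = x e

/-- The expectation of a random variable `R` that depends on the index of the sampled tree, where
the index `i` is sampled with probability `coeff i`. -/
def TreeDecomposition.expectation {x : Sym2 V → ℝ} (D : TreeDecomposition x)
    (R : Fin D.size → ℝ) : ℝ := ∑ i, D.coeff i * R i

/-- The set of wrong degree vertices: `s` or `t` if of even degree in `J`, and every other vertex
of odd degree in `J`. -/
def wrongDegree (s t : V) (J : Finset (Sym2 V)) : Finset V :=
  Finset.univ.filter fun v =>
    if v = s ∨ v = t then Even (cut {v} ∩ J).card else Odd (cut {v} ∩ J).card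

/-- `F` is a `T`-join: `T` is the set of vertices of odd degree in `(V, F)`. -/
def IsTJoin (T : Finset V) (F : Finset (Sym2 V)) : Prop :=
  F ⊆ edges V ∧ ∀ v, Odd (cut {v} ∩ F).card ↔ v ∈ T

/-- `F` is a `T`-join of minimum cost. -/
def IsMinTJoin (c : Sym2 V → ℝ) (T : Finset V) (F : Finset (Sym2 V)) : Prop :=
  IsTJoin T F ∧ ∀ F', IsTJoin T F' → ∑ e ∈ F, c e ≤ ∑ e ∈ F', c e

/-- `w` is an Eulerian traversal from `s` to `t` of the disjoint union of `J` and `F`, in which an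
edge of `J ∩ F` occurs twice: `w` uses every edge as often as it occurs in that multigraph. -/
def IsEulerianTraversal {s t : V} (J F : Finset (Sym2 V))
    (w : (⊤ : SimpleGraph V).Walk s t) : Prop :=
  (w.edges : Multiset (Sym2 V)) = J.val + F.val

/-- `p` is a Hamiltonian path from `s` to `t` obtained from the walk `w` by shortcutting, that is,
by skipping vertices of `w`. -/
def IsShortcut {s t : V} (w p : (⊤ : SimpleGraph V).Walk s t) : Prop :=
  p.IsHamiltonian ∧ List.Sublist p.support w.support

/-- The cost of a walk in the complete graph. -/
def walkCost (c : Sym2 V → ℝ) {s t : V} (p : (⊤ : SimpleGraph V).Walk s t) : ℝ :=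
  (p.edges.map c).sum

end PathTSP

set_option linter.unusedSectionVars false

namespace PathTSP

variable {V : Type*} [Fintype V] [DecidableEq V]

open scoped symmDiff

/-! ### Cuts and parities -/

/-! By shortcutting, the output costs at most c(J) + c(F), and E[c(J)] = c(x). It remains to bound
E[c(F)]. A minimum T-join costs at most c(y) for every y ≥ 0 with y(δ(S)) ≥ 1 on all cuts that T
meets oddly (`exists_join_cost_le`), so for each tree J a cheap such y is wanted.

Start from αJ + βx. If S contains both or neither of s and t, T-oddness means that J crosses S an
odd number of times, and x(δ(S)) ≥ 2; so α + 2β = 1 suffices. If S separates s from t, T-oddness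
means that J crosses S an even number of times, hence at least twice, and 2α + βx(δ(S)) falls short
of 1 only when x(δ(S)) < τ, where 2α + βτ = 1.

As τ ≤ 2, these narrow cuts (taken on the side of s) form a chain (`narrow_chain`), and a fractional
Hall theorem splits x into parts f_U that put one unit on each narrow cut U
(`exists_narrow_assignment`). Adding (|J ∩ δ(U)| - 1) β(τ - x(δ(U))) f_U for every U repairs the
deficits (`correction_covers`). In expectation the factor |J ∩ δ(U)| - 1 becomes x(δ(U)) - 1, and (z
- 1)(τ - z) ≤ ((τ - 1)/2)². Since the f_U sum to at most x, the expectation of J + y is at most (1 +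
α + β + β((τ - 1)/2)²)x, edge by edge (`expectation_correction_le`); the best β gives the golden
ratio. The comparison with OPT holds because Hamiltonian paths are feasible
(`lpFeasible_of_isHamiltonian`).

The tree decomposition rests on Edmonds' spanning tree polytope (`mem_convexHull_isSpanningTree`),
the traversal on Euler's theorem (`exists_eulerian_walk`). Parities are handled throughout as
vectors over `ZMod 2`, additive under symmetric difference. -/

lemma mk_mem_cut {S : Finset V} {u v : V} :
    s(u, v) ∈ cut S ↔ (u ∈ S ∧ v ∉ S) ∨ (v ∈ S ∧ u ∉ S) := by
  simp only [cut, Finset.mem_filter, Finset.mem_univ, true_and]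
  constructor
  · rintro ⟨a, b, ha, hb, h⟩
    rcases Sym2.eq_iff.1 h with ⟨rfl, rfl⟩ | ⟨rfl, rfl⟩
    · exact Or.inl ⟨ha, hb⟩
    · exact Or.inr ⟨ha, hb⟩
  · rintro (⟨h1, h2⟩ | ⟨h1, h2⟩)
    · exact ⟨u, v, h1, h2, rfl⟩
    · exact ⟨v, u, h1, h2, Sym2.eq_swap⟩

lemma mk_mem_edges {u v : V} : s(u, v) ∈ edges V ↔ u ≠ v := by
  simp [edges]

lemma exists_of_mem_cut {S : Finset V} {e : Sym2 V} (he : e ∈ cut S) :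
    ∃ u v, u ∈ S ∧ v ∉ S ∧ e = s(u, v) := by
  simpa [cut] using he

lemma cut_subset_edges (S : Finset V) : cut S ⊆ edges V := by
  intro e he
  obtain ⟨u, v, hu, hv, rfl⟩ := exists_of_mem_cut he
  rw [mk_mem_edges]
  rintro rfl
  exact hv hu

lemma cut_compl (S : Finset V) : cut Sᶜ = cut S := by
  ext e
  induction e using Sym2.ind with
  | _ u v => simp only [mk_mem_cut, Finset.mem_compl]; tauto

/-- The parity of the number of edges of `F` that cross `S`. -/
def crossParity (F : Finset (Sym2 V)) (S : Finset V) : ZMod 2 := ((cut S ∩ F).card : ZMod 2)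

/-- The parity of the degree of `v` in `(V, F)`. -/
def boundary (F : Finset (Sym2 V)) : V → ZMod 2 := fun v => crossParity F {v}

lemma crossParity_eq_sum (F : Finset (Sym2 V)) (S : Finset V) :
    crossParity F S = ∑ e ∈ F, if e ∈ cut S then 1 else 0 := by
  rw [crossParity, Finset.inter_comm, ← Finset.filter_mem_eq_inter, Finset.card_filter]
  push_cast
  rfl

lemma sum_symmDiff_zmod_two {ι : Type*} [DecidableEq ι] (A B : Finset ι) (f : ι → ZMod 2) :
    ∑ i ∈ A ∆ B, f i = ∑ i ∈ A, f i + ∑ i ∈ B, f i := by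
  have h1 := Finset.sum_inter_add_sum_sdiff A B f
  have h2 := Finset.sum_inter_add_sum_sdiff B A f
  rw [symmDiff_def, Finset.sup_eq_union, Finset.sum_union disjoint_sdiff_sdiff, ← h1, ← h2,
    Finset.inter_comm B A]
  linear_combination -(CharTwo.add_self_eq_zero (∑ i ∈ A ∩ B, f i))

lemma crossParity_symmDiff (A B : Finset (Sym2 V)) (S : Finset V) :
    crossParity (A ∆ B) S = crossParity A S + crossParity B S := by
  simp only [crossParity_eq_sum, sum_symmDiff_zmod_two]

lemma boundary_symmDiff (A B : Finset (Sym2 V)) :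
    boundary (A ∆ B) = boundary A + boundary B := by
  ext v
  exact crossParity_symmDiff A B {v}

/-- The handshake lemma: the parity of a cut is the sum of the parities of the degrees. -/
lemma crossParity_eq_sum_boundary {F : Finset (Sym2 V)} (hF : F ⊆ edges V) (S : Finset V) :
    crossParity F S = ∑ v ∈ S, boundary F v := by
  simp only [boundary, crossParity_eq_sum]
  rw [Finset.sum_comm]
  refine Finset.sum_congr rfl fun e he => ?_
  have he' := hF he
  induction e using Sym2.ind with
  | _ u v =>
    rw [mk_mem_edges] at he'
    have : ∀ w, (if s(u, v) ∈ cut {w} then (1 : ZMod 2) else 0) =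
        (if w = u then 1 else 0) + (if w = v then 1 else 0) := by
      intro w
      simp only [mk_mem_cut, Finset.mem_singleton]
      by_cases h1 : w = u <;> by_cases h2 : w = v <;> grind
    rw [Finset.sum_congr rfl fun w _ => this w, Finset.sum_add_distrib, Finset.sum_ite_eq',
      Finset.sum_ite_eq']
    have h0 : (1 : ZMod 2) + 1 = 0 := CharTwo.add_self_eq_zero 1
    by_cases h1 : u ∈ S <;> by_cases h2 : v ∈ S <;> simp [mk_mem_cut, h1, h2, h0]

lemma boundary_singleton {u v : V} (h : u ≠ v) :
    boundary {s(u, v)} = Pi.single u (1 : ZMod 2) + Pi.single v 1 := by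
  ext w
  simp only [boundary, crossParity_eq_sum, Finset.sum_singleton, mk_mem_cut,
    Finset.mem_singleton, Pi.add_apply, Pi.single_apply]
  by_cases h1 : w = u <;> by_cases h2 : w = v <;> grind

lemma boundary_empty : boundary (∅ : Finset (Sym2 V)) = 0 := by
  ext w
  simp [boundary, crossParity]

lemma add_self_zmod_two {ι : Type*} (b : ι → ZMod 2) : b + b = 0 := by
  ext v
  exact CharTwo.add_self_eq_zero (b v)

lemma single_add_single (u : V) :
    (Pi.single u (1 : ZMod 2) : V → ZMod 2) + Pi.single u 1 = 0 := add_self_zmod_two _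

/-- Adding the steps of a walk by symmetric difference cancels repeated edges, so no simple path has
to be extracted: the boundary keeps only the two ends. -/
lemma exists_join_of_reflTransGen {r : V → V → Prop} {D : Finset (Sym2 V)}
    (hr : ∀ a b, r a b → a ≠ b ∧ s(a, b) ∈ D) {a b : V} (h : Relation.ReflTransGen r a b) :
    ∃ A ⊆ D, A ⊆ edges V ∧ boundary A = Pi.single a (1 : ZMod 2) + Pi.single b 1 := by
  induction h with
  | refl => exact ⟨∅, by simp, by simp, by rw [boundary_empty, single_add_single]⟩
  | @tail b d _ hbd ih =>
    obtain ⟨A, hA, hA', hAb⟩ := ih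
    obtain ⟨hne, hD⟩ := hr _ _ hbd
    refine ⟨A ∆ {s(b, d)}, ?_, ?_, ?_⟩
    · refine (Finset.symmDiff_subset_union).trans (Finset.union_subset hA (by simpa using hD))
    · refine (Finset.symmDiff_subset_union).trans (Finset.union_subset hA' ?_)
      simpa [mk_mem_edges] using hne
    · rw [boundary_symmDiff, hAb, boundary_singleton hne]
      linear_combination single_add_single b

lemma sum_symmDiff_le {ι : Type*} [DecidableEq ι] (A B : Finset ι) (f : ι → ℝ)
    (hf : ∀ i ∈ B, 0 ≤ f i) : ∑ i ∈ A ∆ B, f i ≤ ∑ i ∈ A, f i + ∑ i ∈ B, f i := by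
  have h1 := Finset.sum_inter_add_sum_sdiff A B f
  have h2 := Finset.sum_inter_add_sum_sdiff B A f
  rw [symmDiff_def, Finset.sup_eq_union, Finset.sum_union disjoint_sdiff_sdiff, ← h1, ← h2,
    Finset.inter_comm B A]
  have : 0 ≤ ∑ i ∈ A ∩ B, f i :=
    Finset.sum_nonneg fun i hi => hf i (Finset.mem_inter.1 hi).2
  linarith

/-- Exchanging along `B` changes the cost by a signed length of `B`, in which the elements of `A`
count negatively. -/
lemma sum_symmDiff_eq {ι : Type*} [DecidableEq ι] (A B : Finset ι) (f : ι → ℝ) :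
    ∑ i ∈ A ∆ B, f i = ∑ i ∈ A, f i + ∑ i ∈ B, if i ∈ A then - f i else f i := by
  have h1 := Finset.sum_inter_add_sum_sdiff A B f
  have h2 := Finset.sum_inter_add_sum_sdiff B A fun i => if i ∈ A then - f i else f i
  rw [symmDiff_def, Finset.sup_eq_union, Finset.sum_union disjoint_sdiff_sdiff, ← h1, ← h2]
  have h3 : ∑ i ∈ B \ A, (if i ∈ A then - f i else f i) = ∑ i ∈ B \ A, f i :=
    Finset.sum_congr rfl fun i hi => if_neg (Finset.mem_sdiff.1 hi).2
  have h4 : ∑ i ∈ B ∩ A, (if i ∈ A then - f i else f i) = - ∑ i ∈ A ∩ B, f i := by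
    rw [Finset.inter_comm B A, ← Finset.sum_neg_distrib]
    exact Finset.sum_congr rfl fun i hi => if_pos (Finset.mem_inter.1 hi).1
  rw [h3, h4]
  ring

lemma symmDiff_subset_edges {A B : Finset (Sym2 V)} (hA : A ⊆ edges V) (hB : B ⊆ edges V) :
    A ∆ B ⊆ edges V :=
  Finset.symmDiff_subset_union.trans (Finset.union_subset hA hB)

/-! ### The fractional T-join theorem -/

/-- `F` is an edge set of minimum cost among those with boundary `b`. -/
structure IsMinJoin (c : Sym2 V → ℝ) (b : V → ZMod 2) (F : Finset (Sym2 V)) : Prop where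
  subset : F ⊆ edges V
  boundary_eq : boundary F = b
  le : ∀ F' ⊆ edges V, boundary F' = b → ∑ e ∈ F, c e ≤ ∑ e ∈ F', c e

lemma exists_isMinJoin (c : Sym2 V → ℝ) {b : V → ZMod 2}
    (h : ∃ F ⊆ edges V, boundary F = b) : ∃ F, IsMinJoin c b F := by
  classical
  obtain ⟨F, hF, hFb⟩ := h
  obtain ⟨G, hG, hmin⟩ := Finset.exists_min_image
    ((edges V).powerset.filter fun F => boundary F = b) (fun F => ∑ e ∈ F, c e)
    ⟨F, by simp [hF, hFb]⟩
  simp only [Finset.mem_filter, Finset.mem_powerset] at hG hmin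
  exact ⟨G, hG.1, hG.2, fun F' h1 h2 => hmin F' ⟨h1, h2⟩⟩

/-- If minimum-cost joins have positive cost, then there is a cut of positive costs that every
minimum-cost join crosses exactly once. -/
lemma exists_cut_card_inter_eq_one {c : Sym2 V → ℝ} (hc : ∀ e ∈ edges V, 0 ≤ c e)
    {b : V → ZMod 2} {F₀ : Finset (Sym2 V)} (hF₀ : IsMinJoin c b F₀)
    (hpos : 0 < ∑ e ∈ F₀, c e) :
    ∃ S : Finset V, (∀ e ∈ cut S, 0 < c e) ∧ ∀ F, IsMinJoin c b F → (cut S ∩ F).card = 1 := by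
  classical
  obtain ⟨e₀, he₀, hce₀⟩ : ∃ e ∈ F₀, 0 < c e := by
    by_contra! h
    exact absurd (Finset.sum_nonpos h) (not_le.2 hpos)
  have he₀' := hF₀.subset he₀
  obtain ⟨x₀, u₀, rfl⟩ : ∃ x u, e₀ = s(x, u) := by
    induction e₀ using Sym2.ind with
    | _ x u => exact ⟨x, u, rfl⟩
  rw [mk_mem_edges] at he₀'
  -- `G` is cheapest among all sets whose boundary differs from `b` by `x₀` and one free vertex `v`.
  -- Deleting `e₀` from `F₀` shows that `G` is strictly cheaper than `F₀`. The cut below depends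
  -- only on `v` and the costs, so it serves every minimum join `F`.
  obtain ⟨G, hG, hGmin⟩ := Finset.exists_min_image
    ((edges V).powerset.filter fun G => ∃ v, boundary G = b + Pi.single x₀ 1 + Pi.single v 1)
    (fun F => ∑ e ∈ F, c e)
    ⟨F₀, by
      simp only [Finset.mem_filter, Finset.mem_powerset]
      refine ⟨hF₀.subset, x₀, ?_⟩
      rw [hF₀.boundary_eq]
      linear_combination -(single_add_single x₀)⟩
  simp only [Finset.mem_filter, Finset.mem_powerset] at hG hGmin
  obtain ⟨hGE, v, hGv⟩ := hG
  replace hGmin : ∀ G' ⊆ edges V, ∀ u, boundary G' = b + Pi.single x₀ 1 + Pi.single u 1 →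
      ∑ e ∈ G, c e ≤ ∑ e ∈ G', c e := fun G' h1 u h2 => hGmin G' ⟨h1, u, h2⟩
  have hlt : ∑ e ∈ G, c e < ∑ e ∈ F₀, c e := by
    have h1 := hGmin (F₀ ∆ {s(x₀, u₀)})
      (symmDiff_subset_edges hF₀.subset (by simpa [mk_mem_edges] using he₀')) u₀
      (by rw [boundary_symmDiff, boundary_singleton he₀', hF₀.boundary_eq]; ring)
    rw [sum_symmDiff_eq, Finset.sum_singleton, if_pos he₀] at h1
    linarith
  -- the vertices joined to `v` by edges of cost zero
  let z : V → V → Prop := fun a b => a ≠ b ∧ c s(a, b) = 0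
  let S : Finset V := Finset.univ.filter fun u => Relation.ReflTransGen z v u
  have hS : ∀ u, u ∈ S ↔ Relation.ReflTransGen z v u := by simp [S]
  have hvS : v ∈ S := (hS v).2 .refl
  have hcut : ∀ e ∈ cut S, 0 < c e := by
    intro e he
    have heE := cut_subset_edges S he
    obtain ⟨a, d, ha, hd, rfl⟩ := exists_of_mem_cut he
    refine lt_of_le_of_ne (hc _ heE) fun h0 => hd ?_
    exact (hS d).2 (((hS a).1 ha).tail ⟨mk_mem_edges.1 heE, h0.symm⟩)
  -- zero-cost joins inside `S`
  have hzero : ∀ a ∈ S, ∀ d ∈ S, ∃ A ⊆ edges V, (∀ e ∈ A, c e = 0) ∧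
      boundary A = Pi.single a (1 : ZMod 2) + Pi.single d 1 := by
    intro a ha d hd
    have hz : ∀ a b, z a b → a ≠ b ∧ s(a, b) ∈ Finset.univ.filter fun e => c e = 0 := by
      intro a b h; simpa [z] using h
    obtain ⟨A, hA, hAE, hAb⟩ := exists_join_of_reflTransGen hz ((hS a).1 ha)
    obtain ⟨B, hB, hBE, hBb⟩ := exists_join_of_reflTransGen hz ((hS d).1 hd)
    refine ⟨A ∆ B, symmDiff_subset_edges hAE hBE, ?_, ?_⟩
    · intro e he
      rcases Finset.mem_union.1 (Finset.symmDiff_subset_union he) with h | h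
      · simpa using hA h
      · simpa using hB h
    · rw [boundary_symmDiff, hAb, hBb]
      linear_combination single_add_single v
  have hadd : ∀ X A : Finset (Sym2 V), (∀ e ∈ A, c e = 0) →
      ∑ e ∈ X ∆ A, c e ≤ ∑ e ∈ X, c e := by
    intro X A hA
    have := sum_symmDiff_le X A c fun e he => (hA e he).ge
    rwa [Finset.sum_eq_zero hA, add_zero] at this
  refine ⟨S, hcut, fun F hF => ?_⟩
  have hltF : ∑ e ∈ G, c e < ∑ e ∈ F, c e := hlt.trans_le (hF₀.le F hF.subset hF.boundary_eq)
  -- Otherwise a free connection from `x₀` to `v` would turn `G` into a join with boundary `b`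
  -- cheaper than `F`.
  have hx₀ : x₀ ∉ S := by
    intro hx
    obtain ⟨A, hAE, hA0, hAb⟩ := hzero x₀ hx v hvS
    have h1 := hF.le (G ∆ A) (symmDiff_subset_edges hGE hAE)
      (by rw [boundary_symmDiff, hGv, hAb]
          linear_combination single_add_single v + single_add_single x₀)
    linarith [hadd G A hA0]
  let D := F ∆ G
  have hDE : D ⊆ edges V := symmDiff_subset_edges hF.subset hGE
  have hDb : boundary D = Pi.single x₀ (1 : ZMod 2) + Pi.single v 1 := by
    rw [boundary_symmDiff, hF.boundary_eq, hGv]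
    linear_combination add_self_zmod_two b
  have hFD : F ∆ D = G := symmDiff_symmDiff_cancel_left F G
  -- Explore `D` from `x₀` while staying outside `S`. By parity `D` must leave the explored set `R`,
  -- and it can do so only by an edge into `S`.
  let r : V → V → Prop := fun a d => a ≠ d ∧ s(a, d) ∈ D ∧ a ∉ S ∧ d ∉ S
  let R : Finset V := Finset.univ.filter fun u => Relation.ReflTransGen r x₀ u
  have hR : ∀ u, u ∈ R ↔ Relation.ReflTransGen r x₀ u := by simp [R]
  have hRS : ∀ u ∈ R, u ∉ S := by
    intro u hu
    rcases ((hR u).1 hu).cases_tail with rfl | ⟨y, _, hy⟩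
    · exact hx₀
    · exact hy.2.2.2
  have hvR : v ∉ R := fun h => hRS v h hvS
  have hodd : crossParity D R = 1 := by
    rw [crossParity_eq_sum_boundary hDE, hDb]
    simp only [Pi.add_apply, Pi.single_apply, Finset.sum_add_distrib, Finset.sum_ite_eq', hvR,
      if_false, add_zero]
    rw [if_pos ((hR x₀).2 .refl)]
  obtain ⟨g, hg⟩ : (cut R ∩ D).Nonempty := by
    rw [Finset.nonempty_iff_ne_empty]
    intro h
    rw [crossParity, h] at hodd
    simp at hodd
  obtain ⟨hgR, hgD⟩ := Finset.mem_inter.1 hg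
  have hgE := hDE hgD
  obtain ⟨y, a, hy, haR, rfl⟩ := exists_of_mem_cut hgR
  have hya := mk_mem_edges.1 hgE
  have haS : a ∈ S := by
    by_contra h
    exact haR ((hR a).2 (((hR y).1 hy).tail ⟨hya, hgD, hRS y hy, h⟩))
  have hgS : s(y, a) ∈ cut S := mk_mem_cut.2 (Or.inr ⟨haS, hRS y hy⟩)
  obtain ⟨A, hAD, hAE, hAb⟩ := exists_join_of_reflTransGen (r := r)
    (D := D.filter fun e => e ∉ cut S) (by
      intro a d h
      refine ⟨h.1, Finset.mem_filter.2 ⟨h.2.1, ?_⟩⟩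
      rw [mk_mem_cut]
      tauto) ((hR y).1 hy)
  have hAS : ∀ e ∈ A, e ∉ cut S := fun e he => (Finset.mem_filter.1 (hAD he)).2
  replace hAD : A ⊆ D := fun e he => (Finset.mem_filter.1 (hAD he)).1
  have hgA : s(y, a) ∉ A := fun h => hAS _ h hgS
  let σ : Sym2 V → ℝ := fun e => if e ∈ F then - c e else c e
  have hσ : ∀ X, ∑ e ∈ F ∆ X, c e = ∑ e ∈ F, c e + ∑ e ∈ X, σ e :=
    fun X => sum_symmDiff_eq F X c
  -- `D₁` leads from `x₀` into `S` through a single edge of the cut. The rest of `D` has boundary `a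
  -- + v` with both vertices in `S`; closed up at no cost, it yields a competitor of `F`. So its
  -- signed length is nonnegative, and `F ∆ D₁` costs no more than `G`.
  let D₁ := insert s(y, a) A
  have hD₁ : D₁ = A ∆ {s(y, a)} := by
    ext e
    simp only [D₁, Finset.mem_insert, Finset.mem_symmDiff, Finset.mem_singleton]
    constructor
    · rintro (rfl | h)
      · exact Or.inr ⟨rfl, hgA⟩
      · exact Or.inl ⟨h, fun h' => hgA (h' ▸ h)⟩
    · rintro (h | h)
      · exact Or.inr h.1
      · exact Or.inl h.1
  have hD₁D : D₁ ⊆ D := Finset.insert_subset hgD hAD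
  have hD₁E : D₁ ⊆ edges V := hD₁D.trans hDE
  have hD₁b : boundary D₁ = Pi.single x₀ (1 : ZMod 2) + Pi.single a 1 := by
    rw [hD₁, boundary_symmDiff, hAb, boundary_singleton hya]
    linear_combination single_add_single y
  have hD₂ : D \ D₁ = D ∆ D₁ := by
    ext e
    have := @hD₁D e
    simp only [Finset.mem_sdiff, Finset.mem_symmDiff]
    tauto
  have hD₂σ : 0 ≤ ∑ e ∈ D \ D₁, σ e := by
    obtain ⟨B, hBE, hB0, hBb⟩ := hzero a haS v hvS
    have h1 := hF.le ((F ∆ (D \ D₁)) ∆ B)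
      (symmDiff_subset_edges (symmDiff_subset_edges hF.subset
        (Finset.sdiff_subset.trans hDE)) hBE)
      (by rw [boundary_symmDiff, boundary_symmDiff, hD₂, boundary_symmDiff, hF.boundary_eq, hDb,
            hD₁b, hBb]
          linear_combination single_add_single v + single_add_single x₀ + single_add_single a)
    have h2 := hadd (F ∆ (D \ D₁)) B hB0
    rw [hσ] at h2
    linarith
  have hD₁σ : ∑ e ∈ F, c e + ∑ e ∈ D₁, σ e ≤ ∑ e ∈ G, c e := by
    have h1 := hσ D
    rw [hFD, ← Finset.sum_sdiff hD₁D] at h1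
    linarith
  have hsub : cut S ∩ F ⊆ {s(y, a)} := by
    intro e he
    obtain ⟨heS, heF⟩ := Finset.mem_inter.1 he
    have heE := hF.subset heF
    suffices h : e ∈ D₁ by
      rcases Finset.mem_insert.1 h with h | h
      · simp [h]
      · exact absurd heS (hAS e h)
    -- A second edge of `F` across the cut could be deleted from `F ∆ D₁` as well, and a free
    -- connection inside `S` restores the required form of the boundary: a candidate strictly
    -- cheaper than `G`.
    by_contra heD
    have hce := hcut e heS
    obtain ⟨a', d, ha', hd, rfl⟩ := exists_of_mem_cut heS
    obtain ⟨B, hBE, hB0, hBb⟩ := hzero a haS a' ha'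
    have h1 := hGmin ((F ∆ insert s(a', d) D₁) ∆ B)
      (symmDiff_subset_edges (symmDiff_subset_edges hF.subset
        (Finset.insert_subset heE hD₁E)) hBE) d
      (by
        have : insert s(a', d) D₁ = D₁ ∆ {s(a', d)} := by
          ext e
          simp only [Finset.mem_insert, Finset.mem_symmDiff, Finset.mem_singleton]
          constructor
          · rintro (rfl | h)
            · exact Or.inr ⟨rfl, heD⟩
            · exact Or.inl ⟨h, fun h' => heD (h' ▸ h)⟩
          · rintro (h | h)
            · exact Or.inr h.1
            · exact Or.inl h.1
        rw [boundary_symmDiff, boundary_symmDiff, this, boundary_symmDiff, hF.boundary_eq,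
          hD₁b, hBb, boundary_singleton (mk_mem_edges.1 heE)]
        linear_combination single_add_single a + single_add_single a')
    have h2 := hadd (F ∆ insert s(a', d) D₁) B hB0
    rw [hσ, Finset.sum_insert heD] at h2
    have h3 : σ s(a', d) = - c s(a', d) := if_pos heF
    linarith
  have hgF : s(y, a) ∈ F := by
    -- If the crossing edge were not in `F`, stopping at `y` would save its positive cost and again
    -- beat `G`.
    by_contra hgF
    have h1 := hGmin (F ∆ A) (symmDiff_subset_edges hF.subset hAE) y
      (by rw [boundary_symmDiff, hF.boundary_eq, hAb]; ring)
    rw [hσ] at h1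
    rw [Finset.sum_insert hgA] at hD₁σ
    have h3 : σ s(y, a) = c s(y, a) := if_neg hgF
    linarith [hcut _ hgS]
  rw [Finset.card_eq_one]
  exact ⟨s(y, a), Finset.Subset.antisymm hsub
    (Finset.singleton_subset_iff.2 (Finset.mem_inter.2 ⟨hgS, hgF⟩))⟩

lemma exists_pos_forall_le {ι : Type*} (s : Finset ι) (f : ι → ℝ) (hf : ∀ i ∈ s, 0 < f i) :
    ∃ ε > 0, ∀ i ∈ s, ε ≤ f i := by
  rcases s.eq_empty_or_nonempty with rfl | hs
  · exact ⟨1, one_pos, by simp⟩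
  · obtain ⟨i, hi, hmin⟩ := s.exists_min_image f hs
    exact ⟨f i, hf i hi, hmin⟩

/-- A fractional solution of the covering problem for the odd cuts costs at least as much as some
join. -/
theorem exists_join_cost_le {c y : Sym2 V → ℝ} (hc : ∀ e ∈ edges V, 0 ≤ c e)
    (hy : ∀ e ∈ edges V, 0 ≤ y e) {b : V → ZMod 2} (hb : ∃ F ⊆ edges V, boundary F = b)
    (hcov : ∀ S : Finset V, ∑ v ∈ S, b v = 1 → 1 ≤ ∑ e ∈ cut S, y e) :
    ∃ F ⊆ edges V, boundary F = b ∧ ∑ e ∈ F, c e ≤ ∑ e ∈ edges V, c e * y e := by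
  classical
  by_contra! hcon
  obtain ⟨F₀, hF₀⟩ := exists_isMinJoin c hb
  let d := ∑ e ∈ F₀, c e - ∑ e ∈ edges V, c e * y e
  have hd : 0 < d := sub_pos.2 (hcon F₀ hF₀.subset hF₀.boundary_eq)
  -- The cost vectors below `c` for which the gap `d` between joins and `y` persists. One with the
  -- least total will be lowered further along a cut, a contradiction.
  let K : Set (Sym2 V → ℝ) := (Set.univ.pi fun e => Set.Icc 0 (if e ∈ edges V then c e else 0)) ∩
    ⋂ F : {F : Finset (Sym2 V) // F ⊆ edges V ∧ boundary F = b},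
      {c' | ∑ e ∈ edges V, c' e * y e + d ≤ ∑ e ∈ F.1, c' e}
  have hK : IsCompact K := by
    refine (isCompact_univ_pi fun e => isCompact_Icc).inter_right ?_
    refine isClosed_iInter fun F => isClosed_le ?_ ?_ <;> fun_prop
  have hKne : K.Nonempty := by
    refine ⟨fun e => if e ∈ edges V then c e else 0, ?_, ?_⟩
    · intro e _
      by_cases h : e ∈ edges V
      · simp [h, hc e h]
      · simp [h]
    · rw [Set.mem_iInter]
      rintro ⟨F, hF, hFb⟩
      have h1 : ∑ e ∈ edges V, (if e ∈ edges V then c e else 0) * y e =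
          ∑ e ∈ edges V, c e * y e :=
        Finset.sum_congr rfl fun e he => by rw [if_pos he]
      have h2 : ∑ e ∈ F, (if e ∈ edges V then c e else 0) = ∑ e ∈ F, c e :=
        Finset.sum_congr rfl fun e he => by rw [if_pos (hF he)]
      simp only [Set.mem_ofPred_eq, h1, h2]
      linarith [hF₀.le F hF hFb]
  obtain ⟨c', hc', hmin⟩ := hK.exists_isMinOn hKne
    (f := fun c' : Sym2 V → ℝ => ∑ e ∈ edges V, c' e) (by fun_prop)
  obtain ⟨hbox, hgap⟩ := hc'
  have hbox' : ∀ e, 0 ≤ c' e ∧ c' e ≤ if e ∈ edges V then c e else 0 :=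
    fun e => hbox e (Set.mem_univ e)
  replace hgap : ∀ F ⊆ edges V, boundary F = b →
      ∑ e ∈ edges V, c' e * y e + d ≤ ∑ e ∈ F, c' e := fun F h1 h2 =>
    Set.mem_iInter.1 hgap ⟨F, h1, h2⟩
  obtain ⟨F₁, hF₁⟩ := exists_isMinJoin c' hb
  have hpos : 0 < ∑ e ∈ F₁, c' e := by
    have h1 := hgap F₁ hF₁.subset hF₁.boundary_eq
    have h2 : 0 ≤ ∑ e ∈ edges V, c' e * y e :=
      Finset.sum_nonneg fun e he => mul_nonneg (hbox' e).1 (hy e he)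
    linarith
  obtain ⟨S, hSpos, hS⟩ := exists_cut_card_inter_eq_one (fun e _ => (hbox' e).1) hF₁ hpos
  have hSodd : ∑ v ∈ S, b v = 1 := by
    rw [← hF₁.boundary_eq, ← crossParity_eq_sum_boundary hF₁.subset, crossParity, hS F₁ hF₁]
    simp
  obtain ⟨ε₁, hε₁, hε₁'⟩ := exists_pos_forall_le (cut S) c' hSpos
  obtain ⟨ε₂, hε₂, hε₂'⟩ := exists_pos_forall_le
    ((edges V).powerset.filter fun F => ∑ e ∈ F₁, c' e < ∑ e ∈ F, c' e)
    (fun F => (∑ e ∈ F, c' e - ∑ e ∈ F₁, c' e) / (edges V).card) (by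
      intro F hF
      rw [Finset.mem_filter, Finset.mem_powerset] at hF
      refine div_pos (sub_pos.2 hF.2) ?_
      norm_cast
      rw [Finset.card_pos]
      by_contra h
      rw [Finset.not_nonempty_iff_eq_empty] at h
      have h1 := hF.1
      have h2 := hF₁.subset
      rw [h, Finset.subset_empty] at h1 h2
      have := hF.2
      rw [h1, h2] at this
      exact lt_irrefl _ this)
  -- `ε₁` keeps the costs nonnegative. Minimum joins lose exactly `ε`, and the fractional cost loses
  -- at least `ε` because `y` puts at least 1 on the cut. Any other join loses at most `ε` per edge,
  -- so by the choice of `ε₂` it stays at or above the old minimum. Hence the gap survives.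
  let ε := min ε₁ ε₂
  have hε : 0 < ε := lt_min hε₁ hε₂
  let c'' : Sym2 V → ℝ := fun e => c' e - if e ∈ cut S then ε else 0
  have hsumc'' : ∀ F, ∑ e ∈ F, c'' e = ∑ e ∈ F, c' e - (cut S ∩ F).card * ε := by
    intro F
    simp only [c'', Finset.sum_sub_distrib]
    rw [← Finset.sum_filter, Finset.filter_mem_eq_inter, Finset.sum_const, nsmul_eq_mul,
      Finset.inter_comm]
  have hcutE : cut S ∩ edges V = cut S := Finset.inter_eq_left.2 (cut_subset_edges S)
  have hmem : c'' ∈ K := by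
    refine ⟨fun e _ => ?_, ?_⟩
    · have h1 := hbox' e
      simp only [c'', Set.mem_Icc]
      split_ifs with he hE
      · have := (min_le_left ε₁ ε₂).trans (hε₁' e he)
        rw [if_pos hE] at h1
        exact ⟨sub_nonneg.2 this, by linarith⟩
      · exact absurd (cut_subset_edges S he) hE
      · rw [if_pos ‹_›] at h1
        simpa using h1
      · rw [if_neg ‹_›] at h1
        simpa using h1
    · rw [Set.mem_iInter]
      rintro ⟨F, hFE, hFb⟩
      simp only [Set.mem_ofPred_eq]
      have h1 : ∑ e ∈ edges V, c'' e * y e =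
          ∑ e ∈ edges V, c' e * y e - ε * ∑ e ∈ cut S, y e := by
        simp only [c'', sub_mul, Finset.sum_sub_distrib, ite_mul, zero_mul]
        rw [← Finset.sum_filter, Finset.filter_mem_eq_inter, Finset.inter_comm, hcutE,
          Finset.mul_sum]
      have h2 : ε * 1 ≤ ε * ∑ e ∈ cut S, y e := mul_le_mul_of_nonneg_left (hcov S hSodd) hε.le
      have h3 := hgap F₁ hF₁.subset hF₁.boundary_eq
      rw [h1, hsumc'']
      by_cases hF : ∑ e ∈ F₁, c' e < ∑ e ∈ F, c' e
      · have h4 : ε ≤ _ := (min_le_right ε₁ ε₂).trans (hε₂' F (by simp [hFE, hF]))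
        have hcard : ((cut S ∩ F).card : ℝ) ≤ (edges V).card := by
          exact_mod_cast Finset.card_le_card (Finset.inter_subset_right.trans hFE)
        have h0 : (0 : ℝ) ≤ (edges V).card := by positivity
        have h5 : ((cut S ∩ F).card : ℝ) * ε ≤ ∑ e ∈ F, c' e - ∑ e ∈ F₁, c' e := by
          calc ((cut S ∩ F).card : ℝ) * ε ≤ (edges V).card *
                ((∑ e ∈ F, c' e - ∑ e ∈ F₁, c' e) / (edges V).card) := by gcongr
            _ ≤ _ := by
              rw [mul_comm]
              rcases h0.eq_or_lt with h | h
              · rw [← h]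
                simpa using hF.le
              · exact (div_mul_cancel₀ _ h.ne').le
        linarith
      · have hFmin : IsMinJoin c' b F :=
          ⟨hFE, hFb, fun F' h1 h2 => (not_lt.1 hF).trans (hF₁.le F' h1 h2)⟩
        rw [hS F hFmin]
        have := hF₁.le F hFE hFb
        push_cast
        linarith
  have h1 : ∑ e ∈ edges V, c' e ≤ ∑ e ∈ edges V, c'' e := hmin hmem
  rw [hsumc'', hcutE] at h1
  have h2 : 0 < (cut S).card := by
    have := hS F₁ hF₁
    exact (this ▸ one_pos : 0 < (cut S ∩ F₁).card).trans_le
      (Finset.card_le_card Finset.inter_subset_left)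
  have h3 : 0 < ((cut S).card : ℝ) * ε := by positivity
  linarith

/-! ### The spanning tree polytope -/

/-- If all superlevel sets of the nonnegative weights `w` have nonnegative `z`-mass, then
`∑ i, w i * z i` is nonnegative. -/
lemma sum_mul_nonneg_of_superlevel {ι : Type*} (s : Finset ι) (w z : ι → ℝ)
    (hw : ∀ i ∈ s, 0 ≤ w i) (h : ∀ θ > 0, 0 ≤ ∑ i ∈ s with θ ≤ w i, z i) :
    0 ≤ ∑ i ∈ s, w i * z i := by
  classical
  induction s using Finset.strongInduction generalizing w with
  | H s ih =>
    rcases s.eq_empty_or_nonempty with rfl | hs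
    · simp
    obtain ⟨i₀, hi₀, hmin⟩ := s.exists_min_image w hs
    -- Peel off the lowest layer: subtracting the least weight removes `i₀` and shifts the levels,
    -- while the layer itself is a multiple of the total mass.
    have h1 : 0 ≤ ∑ i ∈ s.erase i₀, (w i - w i₀) * z i := by
      refine ih _ (Finset.erase_ssubset hi₀) (fun i => w i - w i₀)
        (fun i hi => sub_nonneg.2 (hmin i (Finset.mem_of_mem_erase hi))) fun θ hθ => ?_
      refine (h (θ + w i₀) (add_pos_of_pos_of_nonneg hθ (hw _ hi₀))).trans_eq ?_
      refine Finset.sum_congr ?_ fun _ _ => rfl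
      ext i
      simp only [Finset.mem_filter, Finset.mem_erase, le_sub_iff_add_le]
      refine ⟨fun ⟨h1, h2⟩ => ⟨⟨?_, h1⟩, h2⟩, fun ⟨h1, h2⟩ => ⟨h1.2, h2⟩⟩
      rintro rfl
      linarith
    have h2 : 0 ≤ w i₀ * ∑ i ∈ s, z i := by
      rcases (hw _ hi₀).eq_or_lt with h0 | h0
      · simp [← h0]
      · have := h _ h0
        rw [Finset.filter_true_of_mem hmin] at this
        positivity
    rw [Finset.sum_erase _ (by simp)] at h1
    have : ∑ i ∈ s, w i * z i = ∑ i ∈ s, (w i - w i₀) * z i + w i₀ * ∑ i ∈ s, z i := by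
      rw [Finset.mul_sum, ← Finset.sum_add_distrib]
      exact Finset.sum_congr rfl fun _ _ => by ring
    linarith

/-- The edges with both ends in `S`. -/
def inside (S : Finset V) : Finset (Sym2 V) := (edges V).filter fun e => ∀ v ∈ e, v ∈ S

lemma mk_mem_inside {S : Finset V} {u v : V} : s(u, v) ∈ inside S ↔ u ≠ v ∧ u ∈ S ∧ v ∈ S := by
  simp [inside, mk_mem_edges]

lemma edgeSet_fromEdgeSet_of_subset {J : Finset (Sym2 V)} (hJ : J ⊆ edges V) :
    (SimpleGraph.fromEdgeSet (J : Set (Sym2 V))).edgeSet = J := by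
  rw [SimpleGraph.edgeSet_fromEdgeSet, sdiff_eq_left, Set.disjoint_left]
  intro e he hd
  have := hJ he
  simp only [edges, Finset.mem_filter] at this
  exact this.2 (by simpa using hd)

lemma isSpanningTree_iff {J : Finset (Sym2 V)} :
    IsSpanningTree J ↔ J ⊆ edges V ∧ (SimpleGraph.fromEdgeSet (J : Set (Sym2 V))).Connected ∧
      J.card + 1 = Fintype.card V := by
  refine and_congr_right fun hJ => ?_
  rw [SimpleGraph.isTree_iff_connected_and_card, edgeSet_fromEdgeSet_of_subset hJ]
  simp

/-- The total weight on the pairs that `H` connects is at most the number of edges of `H`. -/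
lemma sum_reachable_le_card {x : Sym2 V → ℝ} (hx : ∀ e ∈ edges V, 0 ≤ x e)
    (hS : ∀ S : Finset V, S.Nonempty → ∑ e ∈ inside S, x e ≤ S.card - 1)
    {H E : Finset (Sym2 V)} (hE : E ⊆ edges V)
    (hreach : ∀ u v, s(u, v) ∈ E → (SimpleGraph.fromEdgeSet (H : Set (Sym2 V))).Reachable u v) :
    ∑ e ∈ E, x e ≤ H.card := by
  classical
  let G := SimpleGraph.fromEdgeSet (H : Set (Sym2 V))
  let S : G.ConnectedComponent → Finset V := fun C =>
    Finset.univ.filter fun v => G.connectedComponentMk v = C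
  have hmem : ∀ C v, v ∈ S C ↔ G.connectedComponentMk v = C := by simp [S]
  have hcomp : ∀ C, ∑ e ∈ inside (S C), x e ≤ (H ∩ inside (S C)).card := by
    intro C
    obtain ⟨v, hv⟩ := C.exists_rep
    have hne : (S C).Nonempty := ⟨v, (hmem C v).2 hv⟩
    -- A connected component on k vertices has at least k - 1 edges of `H`, which is exactly the
    -- allowance of `x` inside it.
    refine (hS _ hne).trans ?_
    have h1 := C.connected_toSimpleGraph.card_vert_le_card_edgeSet_add_one
    have h2 : Nat.card C = (S C).card := by
      rw [Nat.card_eq_fintype_card, Fintype.card_of_subtype]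
      intro w
      rw [hmem]
      rfl
    have h3 : Nat.card C.toSimpleGraph.edgeSet ≤ (H ∩ inside (S C)).card := by
      rw [← Nat.card_eq_finsetCard]
      refine Nat.card_le_card_of_injective
        (fun e => ⟨Sym2.map Subtype.val e.1, ?_⟩) ?_
      · obtain ⟨e, he⟩ := e
        induction e using Sym2.ind with
        | _ a b =>
          obtain ⟨a, ha⟩ := a
          obtain ⟨b, hb⟩ := b
          rw [SimpleGraph.mem_edgeSet, SimpleGraph.ConnectedComponent.toSimpleGraph_adj,
            SimpleGraph.fromEdgeSet_adj] at he
          simp only [Sym2.map_mk, Finset.mem_inter, mk_mem_inside, hmem]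
          exact ⟨he.1, he.2, ha, hb⟩
      · intro e f hef
        exact Subtype.ext (Sym2.map.injective Subtype.val_injective (congrArg Subtype.val hef))
    rw [h2] at h1
    have : (S C).card ≤ (H ∩ inside (S C)).card + 1 := h1.trans (by omega)
    rw [sub_le_iff_le_add]
    exact_mod_cast this
  have hdisj : ∀ C C', C ≠ C' → Disjoint (inside (S C)) (inside (S C')) := by
    intro C C' hne
    rw [Finset.disjoint_left]
    intro e he he'
    induction e using Sym2.ind with
    | _ a b =>
      simp only [mk_mem_inside, hmem] at he he'
      exact hne (he.2.1.symm.trans he'.2.1)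
  calc ∑ e ∈ E, x e ≤ ∑ C, ∑ e ∈ inside (S C), x e := by
        have hle : ∑ e ∈ E, x e ≤ ∑ e ∈ Finset.univ.biUnion fun C => inside (S C), x e := by
          refine Finset.sum_le_sum_of_subset_of_nonneg ?_ ?_
          · intro e he
            induction e using Sym2.ind with
            | _ a b =>
              rw [Finset.mem_biUnion]
              refine ⟨G.connectedComponentMk a, Finset.mem_univ _, mk_mem_inside.2
                ⟨mk_mem_edges.1 (hE he), (hmem _ _).2 rfl, (hmem _ _).2 ?_⟩⟩
              exact (SimpleGraph.ConnectedComponent.eq.2 (hreach a b he)).symm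
          · intro e he _
            obtain ⟨C, _, hC⟩ := Finset.mem_biUnion.1 he
            exact hx e (Finset.filter_subset _ _ hC)
        rwa [Finset.sum_biUnion fun C _ C' _ hne => hdisj C C' hne] at hle
    _ ≤ ∑ C, ((H ∩ inside (S C)).card : ℝ) := Finset.sum_le_sum fun C _ => hcomp C
    _ = ((Finset.univ.biUnion fun C => H ∩ inside (S C)).card : ℝ) := by
        rw [Finset.card_biUnion]
        · push_cast; rfl
        · exact fun C _ C' _ hne => (hdisj C C' hne).mono Finset.inter_subset_right
            Finset.inter_subset_right
    _ ≤ H.card := by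
        exact_mod_cast Finset.card_le_card
          (Finset.biUnion_subset.2 fun C _ => Finset.inter_subset_left)

lemma exists_isSpanningTree [Nonempty V] : ∃ J : Finset (Sym2 V), IsSpanningTree J := by
  classical
  obtain ⟨T, -, hT⟩ := (SimpleGraph.connected_top (V := V)).exists_isTree_le
  refine ⟨T.edgeFinset, ?_, ?_⟩
  · intro e he
    rw [SimpleGraph.mem_edgeFinset] at he
    simp [edges, T.not_isDiag_of_mem_edgeSet he]
  · simpa using hT

/-- Exchanging an edge of the fundamental cycle of `s(a, b)`. -/
lemma IsSpanningTree.exists_exchange {J : Finset (Sym2 V)} (hJ : IsSpanningTree J) {a b : V}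
    (hab : a ≠ b) {H : Finset (Sym2 V)} (hH : H ⊆ J) (hHe : s(a, b) ∈ J → s(a, b) ∈ H)
    (hreach : ¬ (SimpleGraph.fromEdgeSet (H : Set (Sym2 V))).Reachable a b) :
    ∃ f ∈ J, f ∉ H ∧ s(a, b) ∉ J ∧ IsSpanningTree (insert s(a, b) (J.erase f)) := by
  classical
  have hJE := hJ.1
  obtain ⟨-, hconn, hcard⟩ := isSpanningTree_iff.1 hJ
  obtain ⟨p, hp⟩ := hconn.exists_isPath a b
  -- The tree path from `a` to `b` must leave `H`. Its edge `f` then lies on the cycle closed by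
  -- `s(a, b)`, so it is not a bridge and can be dropped.
  obtain ⟨f, hfp, hfH⟩ : ∃ f ∈ p.edges, f ∉ H := by
    by_contra! h
    refine hreach ⟨p.transfer _ fun e he => ?_⟩
    rw [edgeSet_fromEdgeSet_of_subset (hH.trans hJE)]
    exact h e he
  have hfJ : f ∈ J := by
    have := p.edges_subset_edgeSet hfp
    rwa [edgeSet_fromEdgeSet_of_subset hJE] at this
  have heJ : s(a, b) ∉ J := by
    intro he
    refine hreach (SimpleGraph.Adj.reachable ?_)
    simpa [hab] using hHe he
  let J' := insert s(a, b) J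
  have hJ'E : J' ⊆ edges V := Finset.insert_subset (mk_mem_edges.2 hab) hJE
  let G' := SimpleGraph.fromEdgeSet (J' : Set (Sym2 V))
  have hle : SimpleGraph.fromEdgeSet (J : Set (Sym2 V)) ≤ G' :=
    SimpleGraph.fromEdgeSet_mono (by simp [J'])
  have hadj : G'.Adj b a := by simp [G', J', hab.symm, Sym2.eq_swap]
  have hcyc : (SimpleGraph.Walk.cons hadj (p.mapLe hle)).IsCycle := by
    rw [SimpleGraph.Walk.cons_isCycle_iff]
    refine ⟨hp.mapLe hle, fun h => heJ ?_⟩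
    rw [SimpleGraph.Walk.edges_mapLe_eq_edges] at h
    have := p.edges_subset_edgeSet h
    rw [edgeSet_fromEdgeSet_of_subset hJE] at this
    rwa [Sym2.eq_swap]
  have hconn' : (G'.deleteEdges {f}).Connected := by
    have hnb : ¬ G'.IsBridge f := fun hb => hb.notMem_edges_of_isCycle hcyc (by
      simp [hfp])
    induction f using Sym2.ind with
    | _ u v => exact (hconn.mono hle).connected_delete_edge_of_not_isBridge hnb
  have hJ'f : insert s(a, b) (J.erase f) = J'.erase f := by
    rw [Finset.erase_insert_of_ne]
    rintro rfl
    exact heJ hfJ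
  refine ⟨f, hfJ, hfH, heJ, ?_⟩
  rw [isSpanningTree_iff]
  refine ⟨Finset.insert_subset (mk_mem_edges.2 hab) ((Finset.erase_subset _ _).trans hJE), ?_, ?_⟩
  · rw [hJ'f]
    convert hconn' using 1
    ext u v
    simp only [SimpleGraph.fromEdgeSet_adj, Finset.coe_erase, SimpleGraph.deleteEdges_adj, G',
      Set.mem_sdiff]
    tauto
  · rw [Finset.card_insert_of_notMem (by simp [heJ]), Finset.card_erase_of_mem hfJ]
    have := Finset.card_pos.2 ⟨f, hfJ⟩
    omega

/-- The greedy algorithm: some spanning tree is at most as expensive as a point that satisfies the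
constraints of the spanning tree polytope. -/
lemma exists_isSpanningTree_sum_le {x : Sym2 V → ℝ} (hx : ∀ e ∈ edges V, 0 ≤ x e)
    (htot : ∑ e ∈ edges V, x e = Fintype.card V - 1)
    (hS : ∀ S : Finset V, S.Nonempty → ∑ e ∈ inside S, x e ≤ S.card - 1) [Nonempty V]
    (w : Sym2 V → ℝ) :
    ∃ J, IsSpanningTree J ∧ ∑ e ∈ J, w e ≤ ∑ e ∈ edges V, w e * x e := by
  classical
  obtain ⟨J₀, hJ₀⟩ := exists_isSpanningTree (V := V)
  obtain ⟨J, hJ, hmin⟩ := Finset.exists_min_image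
    (Finset.univ.filter fun J : Finset (Sym2 V) => IsSpanningTree J) (fun J => ∑ e ∈ J, w e)
    ⟨J₀, by simpa using hJ₀⟩
  simp only [Finset.mem_filter, Finset.mem_univ, true_and] at hJ hmin
  refine ⟨J, hJ, ?_⟩
  have hJE := hJ.1
  -- In a minimum tree the tree edges of weight at most `θ` connect the ends of every edge of weight
  -- at most `θ`; otherwise an exchange would replace a heavier tree edge.
  have hlevel : ∀ θ, ∑ e ∈ edges V with w e ≤ θ, x e ≤ (J.filter fun e => w e ≤ θ).card := by
    intro θ
    refine sum_reachable_le_card hx hS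
      (Finset.filter_subset _ _) fun a b he => ?_
    rw [Finset.mem_filter, mk_mem_edges] at he
    by_contra hreach
    obtain ⟨f, hfJ, hfH, heJ, hJ'⟩ :=
      hJ.exists_exchange he.1 (Finset.filter_subset _ _)
        (fun h => Finset.mem_filter.2 ⟨h, he.2⟩) hreach
    have h1 := hmin _ hJ'
    rw [Finset.sum_insert (by simp [heJ])] at h1
    have h2 := Finset.add_sum_erase J w hfJ
    have h3 : θ < w f := by
      by_contra h
      exact hfH (Finset.mem_filter.2 ⟨hfJ, not_lt.1 h⟩)
    linarith [he.2]
  let M := ∑ e ∈ edges V, |w e|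
  have hM : ∀ e ∈ edges V, w e ≤ M := fun e he =>
    (le_abs_self _).trans (Finset.single_le_sum (fun e _ => abs_nonneg (w e)) he)
  have hind : ∀ g : Sym2 V → ℝ, ∑ e ∈ edges V, g e * (if e ∈ J then 1 else 0) = ∑ e ∈ J, g e := by
    intro g
    simp only [mul_ite, mul_one, mul_zero]
    rw [← Finset.sum_filter, Finset.filter_mem_eq_inter, Finset.inter_eq_right.2 hJE]
  -- The shift by `M` only makes the weights nonnegative; it cancels because `J` and `x` have the
  -- same total, |V| - 1.
  have key := sum_mul_nonneg_of_superlevel (edges V) (fun e => M - w e)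
    (fun e => (if e ∈ J then 1 else 0) - x e) (fun e he => sub_nonneg.2 (hM e he)) (by
      intro θ _
      have h1 := hlevel (M - θ)
      have h2 : (edges V).filter (fun e => θ ≤ M - w e) =
          (edges V).filter fun e => w e ≤ M - θ := by
        refine Finset.filter_congr fun e _ => ?_
        rw [le_sub_comm]
      have h3 : ((J.filter fun e => w e ≤ M - θ).card : ℝ) =
          ∑ e ∈ edges V with w e ≤ M - θ, if e ∈ J then (1 : ℝ) else 0 := by
        rw [← Finset.sum_filter, Finset.filter_filter, Finset.sum_const, nsmul_eq_mul, mul_one]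
        congr 2
        ext e
        have := @hJE e
        simp only [Finset.mem_filter]
        tauto
      rw [h2, Finset.sum_sub_distrib, ← h3]
      exact sub_nonneg.2 h1)
  have hcard : (∑ e ∈ edges V, if e ∈ J then (1 : ℝ) else 0) = Fintype.card V - 1 := by
    have := hind fun _ => 1
    simp only [one_mul] at this
    rw [this, Finset.sum_const, nsmul_eq_mul, mul_one, ← (isSpanningTree_iff.1 hJ).2.2]
    push_cast
    ring
  have hexp : ∑ e ∈ edges V, (M - w e) * ((if e ∈ J then 1 else 0) - x e) =
      M * ((∑ e ∈ edges V, if e ∈ J then (1 : ℝ) else 0) - ∑ e ∈ edges V, x e) -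
        (∑ e ∈ J, w e - ∑ e ∈ edges V, w e * x e) := by
    rw [← hind, ← Finset.sum_sub_distrib, ← Finset.sum_sub_distrib, Finset.mul_sum,
      ← Finset.sum_sub_distrib]
    exact Finset.sum_congr rfl fun _ _ => by ring
  rw [hexp, hcard, htot] at key
  linarith

/-- Edmonds' description of the spanning tree polytope. -/
theorem mem_convexHull_isSpanningTree [Nonempty V] {x : Sym2 V → ℝ} (hx : ∀ e ∈ edges V, 0 ≤ x e)
    (hdiag : ∀ e ∉ edges V, x e = 0) (htot : ∑ e ∈ edges V, x e = Fintype.card V - 1)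
    (hS : ∀ S : Finset V, S.Nonempty → ∑ e ∈ inside S, x e ≤ S.card - 1) :
    x ∈ convexHull ℝ ((fun (J : Finset (Sym2 V)) (e : Sym2 V) => if e ∈ J then (1 : ℝ) else 0) ''
      {J | IsSpanningTree J}) := by
  classical
  by_contra hcon
  obtain ⟨f, u, hfx, hfJ⟩ := geometric_hahn_banach_point_closed (convex_convexHull ℝ _)
    (((Set.toFinite {J : Finset (Sym2 V) | IsSpanningTree J}).image _).isClosed_convexHull ℝ) hcon
  -- The separating functional is read as an edge weight: a tree no heavier than `x` contradicts the
  -- separation.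
  obtain ⟨J, hJ, hle⟩ := exists_isSpanningTree_sum_le hx htot hS fun e => f (Pi.single e 1)
  have hf : ∀ y : Sym2 V → ℝ, (∀ e ∉ edges V, y e = 0) →
      f y = ∑ e ∈ edges V, f (Pi.single e 1) * y e := by
    intro y hy
    have h1 := LinearMap.pi_apply_eq_sum_univ f.toLinearMap y
    rw [Finset.sum_subset (Finset.subset_univ (edges V)) (fun e _ he => by simp [hy e he])]
    refine h1.trans (Finset.sum_congr rfl fun e _ => ?_)
    have h2 : (fun j => if e = j then (1 : ℝ) else 0) = Pi.single e 1 := by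
      ext e'
      simp [Pi.single_apply, eq_comm]
    rw [smul_eq_mul, mul_comm, h2]
    rfl
  have h1 := hfJ _ (subset_convexHull ℝ _ ⟨J, hJ, rfl⟩)
  rw [hf _ hdiag] at hfx
  rw [hf _ (fun e he => if_neg fun h => he (hJ.1 h))] at h1
  simp only [mul_ite, mul_one, mul_zero] at h1
  rw [← Finset.sum_filter, Finset.filter_mem_eq_inter, Finset.inter_eq_right.2 hJ.1] at h1
  linarith

lemma nonempty_treeDecomposition_of_mem_convexHull {x x' : Sym2 V → ℝ}
    (h : x' ∈ convexHull ℝ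
      ((fun (J : Finset (Sym2 V)) (e : Sym2 V) => if e ∈ J then (1 : ℝ) else 0) ''
        {J | IsSpanningTree J}))
    (hx : ∀ e ∈ edges V, x' e = x e) : Nonempty (TreeDecomposition x) := by
  classical
  obtain ⟨ι, _, w, z, hw, hw1, hz, rfl⟩ := mem_convexHull_iff_exists_fintype.1 h
  choose J hJ hJz using hz
  -- A convex combination may have zero coefficients, a decomposition may not.
  let t := Finset.univ.filter fun i => 0 < w i
  have ht : ∀ g : ι → ℝ, ∑ i : Fin t.card, w (t.equivFin.symm i) * g (t.equivFin.symm i) =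
      ∑ i, w i * g i := by
    intro g
    rw [Equiv.sum_comp t.equivFin.symm fun i : t => w i * g i,
      Finset.sum_coe_sort t fun i => w i * g i]
    refine Finset.sum_subset (Finset.subset_univ _) fun i _ hi => ?_
    have : w i = 0 := le_antisymm (by simpa [t] using hi) (hw i)
    simp [this]
  refine ⟨⟨t.card, fun i => J (t.equivFin.symm i), fun i => w (t.equivFin.symm i),
    fun i => hJ _, fun i => ?_, ?_, fun e he => ?_⟩⟩
  · exact (Finset.mem_filter.1 (t.equivFin.symm i).2).2
  · simpa [hw1] using ht fun _ => 1
  · rw [ht fun i => if e ∈ J i then 1 else 0, ← hx e he, Finset.sum_apply]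
    refine Finset.sum_congr rfl fun i _ => ?_
    rw [Pi.smul_apply, ← hJz, smul_eq_mul]

/-! ### Eulerian traversals -/

/-- The parities of the degrees in a multigraph. -/
def multiBoundary (M : Multiset (Sym2 V)) : V → ZMod 2 := fun v => (M.countP fun e => v ∈ e)

lemma multiBoundary_add (M N : Multiset (Sym2 V)) :
    multiBoundary (M + N) = multiBoundary M + multiBoundary N := by
  ext v
  simp [multiBoundary]

lemma multiBoundary_zero : multiBoundary (0 : Multiset (Sym2 V)) = 0 := by
  ext v
  simp [multiBoundary]

lemma multiBoundary_cons {u v : V} (h : u ≠ v) (M : Multiset (Sym2 V)) :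
    multiBoundary (s(u, v) ::ₘ M) = Pi.single u (1 : ZMod 2) + Pi.single v 1 + multiBoundary M := by
  ext w
  simp only [multiBoundary, Multiset.countP_cons, Sym2.mem_iff, Pi.add_apply, Pi.single_apply]
  by_cases h1 : w = u <;> by_cases h2 : w = v
  · exact absurd (h1.symm.trans h2) h
  all_goals simp [h1, h2, add_comm]
  all_goals (rintro (h | h); all_goals simp_all)

lemma card_cut_inter_eq_countP {F : Finset (Sym2 V)} (hF : F ⊆ edges V) (v : V) :
    (cut {v} ∩ F).card = F.val.countP fun e => v ∈ e := by
  rw [Multiset.countP_eq_card_filter, ← Finset.filter_val, Finset.card_val]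
  congr 1
  ext e
  simp only [Finset.mem_inter, Finset.mem_filter, and_comm (b := e ∈ F)]
  refine and_congr_right fun he => ?_
  replace he := hF he
  induction e using Sym2.ind with
  | _ a b =>
    rw [mk_mem_edges] at he
    simp only [mk_mem_cut, Finset.mem_singleton, Sym2.mem_iff]
    grind

lemma multiBoundary_val {F : Finset (Sym2 V)} (hF : F ⊆ edges V) :
    multiBoundary F.val = boundary F := by
  ext v
  rw [multiBoundary, boundary, crossParity, card_cut_inter_eq_countP hF]

lemma multiBoundary_walk_edges {u v : V} (w : (⊤ : SimpleGraph V).Walk u v) :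
    multiBoundary (w.edges : Multiset (Sym2 V)) = Pi.single u (1 : ZMod 2) + Pi.single v 1 := by
  induction w with
  | nil =>
    rw [single_add_single]
    exact multiBoundary_zero
  | @cons a b d h p ih =>
    rw [SimpleGraph.Walk.edges_cons, ← Multiset.cons_coe, multiBoundary_cons h.ne, ih]
    linear_combination single_add_single b

/-- A maximal trail in a multigraph with at most two vertices `u`, `v` of odd degree. -/
lemma exists_trail (M : Multiset (Sym2 V)) (hM : ∀ e ∈ M, e ∈ edges V) (u v : V)
    (h : multiBoundary M = Pi.single u (1 : ZMod 2) + Pi.single v 1) :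
    ∃ w : (⊤ : SimpleGraph V).Walk u v, (w.edges : Multiset (Sym2 V)) ≤ M ∧
      ((∃ e ∈ M, u ∈ e) → 0 < w.length) := by
  induction hn : M.card generalizing M u with
  | zero =>
    rw [Multiset.card_eq_zero] at hn
    subst hn
    have huv : u = v := by
      by_contra huv
      have := congrFun h u
      simp [multiBoundary, huv] at this
    subst huv
    exact ⟨.nil, by simp, by simp⟩
  | succ n ih =>
    by_cases hu : ∃ e ∈ M, u ∈ e
    · obtain ⟨e, heM, hue⟩ := hu
      obtain ⟨x, rfl⟩ := Sym2.mem_iff_exists.1 hue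
      obtain ⟨N, rfl⟩ := Multiset.exists_cons_of_mem heM
      have hux := mk_mem_edges.1 (hM _ heM)
      -- Removing the first edge moves the odd end from `u` to `x`. The trail can get stuck only at
      -- a vertex without remaining edges, and parity makes that vertex `v`.
      obtain ⟨w, hw, -⟩ := ih N (fun e he => hM e (Multiset.mem_cons_of_mem he)) x (by
        rw [multiBoundary_cons hux] at h
        linear_combination h - single_add_single x) (by simpa using hn)
      refine ⟨.cons (by simpa using hux) w, ?_, fun _ => by simp⟩
      rw [SimpleGraph.Walk.edges_cons, ← Multiset.cons_coe]
      exact (Multiset.cons_le_cons_iff _).2 hw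
    · have huv : u = v := by
        by_contra huv
        have h0 : M.countP (fun e => u ∈ e) = 0 :=
          Multiset.countP_eq_zero.2 fun e he hue => hu ⟨e, he, hue⟩
        have := congrFun h u
        simp [multiBoundary, h0, huv] at this
      subst huv
      exact ⟨.nil, by simp, fun h => absurd h hu⟩

/-- Euler's theorem for connected multigraphs. -/
theorem exists_eulerian_walk (M : Multiset (Sym2 V)) (hM : ∀ e ∈ M, e ∈ edges V) (s t : V)
    (h : multiBoundary M = Pi.single s (1 : ZMod 2) + Pi.single t 1)
    (hconn : ∀ S : Finset V, S.Nonempty → S ≠ Finset.univ → ∃ e ∈ M, e ∈ cut S) :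
    ∃ w : (⊤ : SimpleGraph V).Walk s t, (w.edges : Multiset (Sym2 V)) = M := by
  obtain ⟨w₀, hw₀, -⟩ := exists_trail M hM s t h
  let P : ℕ → Prop := fun n => ∃ w : (⊤ : SimpleGraph V).Walk s t,
    (w.edges : Multiset (Sym2 V)) ≤ M ∧ w.length = n
  have hbound : ∀ n, P n → n ≤ M.card := by
    rintro n ⟨w, hw, rfl⟩
    simpa using Multiset.card_le_card hw
  classical
  -- Take a longest walk within `M`. If edges remain, connectivity provides one that touches the
  -- walk; all remaining degrees are even, so a closed trail starts there, and splicing it in gives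
  -- a longer walk.
  obtain ⟨w, hw, hwn⟩ := Nat.findGreatest_spec (P := P) (hbound _ ⟨w₀, hw₀, rfl⟩) ⟨w₀, hw₀, rfl⟩
  refine ⟨w, ?_⟩
  by_contra hne
  let R := M - (w.edges : Multiset (Sym2 V))
  have hwR : (w.edges : Multiset (Sym2 V)) + R = M := add_tsub_cancel_of_le hw
  have hR : multiBoundary R = 0 := by
    have h1 := h
    rw [← hwR, multiBoundary_add, multiBoundary_walk_edges] at h1
    linear_combination h1
  have hRM : ∀ e ∈ R, e ∈ edges V := fun e he => hM e (Multiset.mem_of_le tsub_le_self he)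
  have hmem : ∀ e ∈ M, e ∉ w.edges → e ∈ R := by
    intro e he hew
    rw [← hwR, Multiset.mem_add] at he
    exact he.resolve_left hew
  obtain ⟨u, hu, e, heR, hue⟩ : ∃ u ∈ w.support, ∃ e ∈ R, u ∈ e := by
    by_contra! hcon
    have hR0 : R ≠ 0 := fun h0 => hne (by rw [← hwR, h0, add_zero])
    obtain ⟨e, he⟩ := Multiset.exists_mem_of_ne_zero hR0
    have hSne : w.support.toFinset ≠ Finset.univ := by
      intro huniv
      induction e using Sym2.ind with
      | _ a b =>
        refine hcon a ?_ _ he (Sym2.mem_mk_left a b)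
        rw [← List.mem_toFinset, huniv]
        exact Finset.mem_univ a
    obtain ⟨f, hfM, hf⟩ := hconn w.support.toFinset ⟨s, by simp⟩ hSne
    obtain ⟨a, b, ha, hb, rfl⟩ := exists_of_mem_cut hf
    rw [List.mem_toFinset] at ha hb
    refine hcon a ha _ (hmem _ hfM fun hfw => hb ?_) (Sym2.mem_mk_left a b)
    exact w.snd_mem_support_of_mem_edges hfw
  obtain ⟨q, hq, hqpos⟩ := exists_trail R hRM u u (by rw [hR, single_add_single])
  let w' := ((w.takeUntil u hu).append q).append (w.dropUntil u hu)
  have hw' : (w'.edges : Multiset (Sym2 V)) = w.edges + q.edges := by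
    have hspec := congrArg SimpleGraph.Walk.edges (w.take_spec hu)
    rw [SimpleGraph.Walk.edges_append] at hspec
    simp only [w', SimpleGraph.Walk.edges_append, ← Multiset.coe_add]
    rw [← hspec, ← Multiset.coe_add]
    abel
  have hlen : w'.length = w.length + q.length := by
    have := congrArg Multiset.card hw'
    simpa using this
  have hP : P w'.length := by
    refine ⟨w', ?_, rfl⟩
    rw [hw', ← hwR]
    exact add_le_add_right hq _
  have := Nat.le_findGreatest (hbound _ hP) hP
  have := hqpos ⟨e, heR, hue⟩
  omega

lemma exists_mem_cut_of_walk {G : SimpleGraph V} {a b : V} (p : G.Walk a b) {S : Finset V}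
    (h : (a ∈ S ∧ b ∉ S) ∨ (a ∉ S ∧ b ∈ S)) : ∃ e ∈ p.edges, e ∈ cut S := by
  rcases h with ⟨ha, hb⟩ | ⟨ha, hb⟩
  · obtain ⟨d, hd, h1, h2⟩ := p.exists_boundary_dart (S : Set V) ha hb
    refine ⟨s(d.fst, d.snd), ?_, mk_mem_cut.2 (Or.inl ⟨h1, h2⟩)⟩
    exact List.mem_map.2 ⟨d, hd, rfl⟩
  · obtain ⟨d, hd, h1, h2⟩ := p.exists_boundary_dart ((S : Set V)ᶜ) ha (by simpa using hb)
    refine ⟨s(d.fst, d.snd), ?_, mk_mem_cut.2 (Or.inr ⟨by simpa using h2, h1⟩)⟩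
    exact List.mem_map.2 ⟨d, hd, rfl⟩

lemma exists_mem_notMem {S : Finset V} (hS : S.Nonempty) (hS' : S ≠ Finset.univ) :
    ∃ a b, a ∈ S ∧ b ∉ S := by
  obtain ⟨a, ha⟩ := hS
  obtain ⟨b, hb⟩ : ∃ b, b ∉ S := by
    by_contra! h
    exact hS' (Finset.eq_univ_iff_forall.2 h)
  exact ⟨a, b, ha, hb⟩

lemma IsSpanningTree.exists_mem_cut {J : Finset (Sym2 V)} (hJ : IsSpanningTree J) {S : Finset V}
    (hS : S.Nonempty) (hS' : S ≠ Finset.univ) : ∃ e ∈ J, e ∈ cut S := by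
  obtain ⟨a, b, ha, hb⟩ := exists_mem_notMem hS hS'
  obtain ⟨p⟩ := hJ.2.connected a b
  obtain ⟨e, he, heS⟩ := exists_mem_cut_of_walk p (Or.inl ⟨ha, hb⟩)
  have := p.edges_subset_edgeSet he
  rw [edgeSet_fromEdgeSet_of_subset hJ.1] at this
  exact ⟨e, this, heS⟩

lemma exists_mem_edges_cut {G : SimpleGraph V} {s t : V} (p : G.Walk s t)
    (hp : ∀ v, v ∈ p.support) {S : Finset V} (hS : S.Nonempty) (hS' : S ≠ Finset.univ) :
    ∃ e ∈ p.edges, e ∈ cut S := by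
  obtain ⟨a, b, ha, hb⟩ := exists_mem_notMem hS hS'
  by_cases hs : s ∈ S
  · obtain ⟨e, he, heS⟩ := exists_mem_cut_of_walk (p.takeUntil b (hp b)) (Or.inl ⟨hs, hb⟩)
    exact ⟨e, p.edges_takeUntil_subset_edges (hp b) he, heS⟩
  · obtain ⟨e, he, heS⟩ := exists_mem_cut_of_walk (p.takeUntil a (hp a)) (Or.inr ⟨hs, ha⟩)
    exact ⟨e, p.edges_takeUntil_subset_edges (hp a) he, heS⟩

/-! ### Shortcuts -/

lemma exists_walk_of_isChain {l : List V} (hne : l ≠ []) (hl : l.IsChain (⊤ : SimpleGraph V).Adj)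
    {s t : V} (hs : l.head hne = s) (ht : l.getLast hne = t) :
    ∃ p : (⊤ : SimpleGraph V).Walk s t, p.support = l := by
  subst hs ht
  exact ⟨SimpleGraph.Walk.ofSupport l hne hl, SimpleGraph.Walk.support_ofSupport hne hl⟩

lemma exists_walk_support_eq {s t : V} (l : List V) (hl : (s :: (l ++ [t])).Nodup) :
    ∃ p : (⊤ : SimpleGraph V).Walk s t, p.support = s :: (l ++ [t]) :=
  exists_walk_of_isChain (List.cons_ne_nil _ _) (hl.imp fun h => by simpa using h).isChain
    (by simp) (by simp)

lemma isHamiltonian_of_support_eq {s t : V} {p : (⊤ : SimpleGraph V).Walk s t}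
    (hp : p.support.Nodup) (h : ∀ v, v ∈ p.support) : p.IsHamiltonian := fun v =>
  List.count_eq_one_of_mem hp (h v)

lemma exists_isHamiltonian {s t : V} (hst : s ≠ t) :
    ∃ p : (⊤ : SimpleGraph V).Walk s t, p.IsHamiltonian := by
  let l := (Finset.univ.filter fun v : V => v ≠ s ∧ v ≠ t).toList
  have hl : ∀ v, v ∈ l ↔ v ≠ s ∧ v ≠ t := by simp [l]
  have hnd : (s :: (l ++ [t])).Nodup := by
    have : l.Nodup := Finset.nodup_toList _
    simp [List.nodup_append, this, hl, hst]
  obtain ⟨p, hp⟩ := exists_walk_support_eq l hnd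
  refine ⟨p, isHamiltonian_of_support_eq (hp ▸ hnd) fun v => ?_⟩
  rw [hp]
  simp only [List.mem_cons, List.mem_append, hl, List.not_mem_nil, or_false]
  tauto

lemma exists_isShortcut {s t : V} (hst : s ≠ t) (w : (⊤ : SimpleGraph V).Walk s t)
    (hw : ∀ v, v ∈ w.support) : ∃ p : (⊤ : SimpleGraph V).Walk s t, IsShortcut w p := by
  obtain ⟨m, hm⟩ : ∃ m, w.support = s :: (m ++ [t]) := by
    rcases List.eq_nil_or_concat' w.support.tail with h | ⟨m, b, h⟩
    · have h1 := w.cons_tail_support.symm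
      have h2 := hw t
      rw [h1, h, List.mem_singleton] at h2
      exact absurd h2.symm hst
    · have h1 := w.cons_tail_support.symm
      rw [h] at h1
      have h2 := w.getLast_support
      simp only [h1] at h2
      refine ⟨m, ?_⟩
      rw [h1]
      simpa using h2
  -- The two ends stay in place; inside, further visits to `s` and `t` and all repetitions are
  -- skipped.
  let l := (m.filter fun v => v ≠ s ∧ v ≠ t).dedup
  have hl : ∀ v, v ∈ l ↔ v ∈ m ∧ v ≠ s ∧ v ≠ t := by simp [l]
  have hnd : (s :: (l ++ [t])).Nodup := by
    have : l.Nodup := List.nodup_dedup _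
    simp [List.nodup_append, this, hl, hst]
  obtain ⟨p, hp⟩ := exists_walk_support_eq l hnd
  refine ⟨p, isHamiltonian_of_support_eq (hp ▸ hnd) fun v => ?_, ?_⟩
  · have := hw v
    rw [hp]
    simp only [hm, List.mem_cons, List.mem_append, hl, List.not_mem_nil, or_false] at this ⊢
    tauto
  · rw [hp, hm]
    exact (((List.dedup_sublist _).trans List.filter_sublist).append_right _).cons_cons _

/-- The sum of the costs of the consecutive pairs of a list of vertices. -/
def chainCost (c : Sym2 V → ℝ) : List V → ℝ
  | [] => 0
  | [_] => 0
  | a :: b :: l => c s(a, b) + chainCost c (b :: l)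

lemma walkCost_eq_chainCost (c : Sym2 V → ℝ) {s t : V} (p : (⊤ : SimpleGraph V).Walk s t) :
    walkCost c p = chainCost c p.support := by
  induction p with
  | nil => simp [walkCost, chainCost]
  | @cons a b d h p ih =>
    rw [SimpleGraph.Walk.support_cons, ← p.cons_tail_support, chainCost, p.cons_tail_support, ← ih]
    simp [walkCost]

lemma chainCost_le_of_sublist {c : Sym2 V → ℝ} (hc : ∀ e, 0 ≤ c e)
    (htri : ∀ u v w, c s(u, w) ≤ c s(u, v) + c s(v, w)) {l l' : List V} (h : l.Sublist l')
    (a : V) : chainCost c (a :: l) ≤ chainCost c (a :: l') := by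
  induction h generalizing a with
  | slnil => exact le_rfl
  | @cons l l' b h ih =>
    have h1 := ih b
    have h2 : chainCost c (a :: l) ≤ c s(a, b) + chainCost c (b :: l) := by
      cases l with
      | nil => simpa [chainCost] using hc _
      | cons d l =>
        simp only [chainCost]
        linarith [htri a b d]
    simp only [chainCost]
    linarith
  | @cons_cons l l' b h ih =>
    simp only [chainCost]
    linarith [ih b]

lemma walkCost_le_of_isShortcut {c : Sym2 V → ℝ} (hc : IsMetricCost c) {s t : V}
    {w p : (⊤ : SimpleGraph V).Walk s t} (h : IsShortcut w p) : walkCost c p ≤ walkCost c w := by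
  -- With zero cost on the diagonal the triangle inequality also holds for coinciding vertices,
  -- which can occur in an arbitrary subsequence of a walk.
  let d : Sym2 V → ℝ := fun e => if e ∈ edges V then c e else 0
  have hd : ∀ q : (⊤ : SimpleGraph V).Walk s t, walkCost c q = walkCost d q := by
    intro q
    rw [walkCost, walkCost]
    congr 1
    refine List.map_congr_left fun e he => (if_pos ?_).symm
    have := q.edges_subset_edgeSet he
    induction e using Sym2.ind with
    | _ a b => simpa [mk_mem_edges] using this
  have hnn : ∀ e, 0 ≤ d e := by
    intro e
    simp only [d]
    split_ifs with he
    exacts [hc.nonneg e he, le_rfl]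
  have htri : ∀ a b e, d s(a, e) ≤ d s(a, b) + d s(b, e) := by
    intro a b e
    have hdiag : ∀ a, d s(a, a) = 0 := fun a => if_neg (by simp [mk_mem_edges])
    by_cases h1 : a = b
    · subst h1; simp [hdiag]
    by_cases h2 : b = e
    · subst h2; simp [hdiag]
    by_cases h3 : a = e
    · subst h3
      rw [hdiag]
      exact add_nonneg (hnn _) (hnn _)
    simpa [d, mk_mem_edges, h1, h2, h3] using hc.triangle a b e h1 h2 h3
  rw [hd, hd, walkCost_eq_chainCost, walkCost_eq_chainCost, ← p.cons_tail_support, ← w.cons_tail_support]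
  have := h.2
  rw [← p.cons_tail_support, ← w.cons_tail_support, List.cons_sublist_cons] at this
  exact chainCost_le_of_sublist hnn htri this s

lemma walkCost_eq_of_isEulerianTraversal {s t : V} (c : Sym2 V → ℝ) {J F : Finset (Sym2 V)}
    {w : (⊤ : SimpleGraph V).Walk s t} (h : IsEulerianTraversal J F w) :
    walkCost c w = ∑ e ∈ J, c e + ∑ e ∈ F, c e := by
  have := congrArg (fun M => (Multiset.map c M).sum) h
  rwa [Multiset.map_add, Multiset.sum_add, Multiset.map_coe, Multiset.sum_coe] at this

/-! ### Hamiltonian paths in the relaxation -/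

lemma countP_edges_le_of_isPath {u v : V} {p : (⊤ : SimpleGraph V).Walk u v} (hp : p.IsPath) :
    p.edges.countP (u ∈ ·) ≤ 1 ∧ ∀ w, p.edges.countP (w ∈ ·) ≤ 2 := by
  induction p with
  | nil => simp
  | @cons a b d h p ih =>
    rw [SimpleGraph.Walk.cons_isPath_iff] at hp
    obtain ⟨h1, h2⟩ := ih hp.1
    have h0 : p.edges.countP (a ∈ ·) = 0 := by
      rw [List.countP_eq_zero]
      intro e he hae
      obtain ⟨x, rfl⟩ := Sym2.mem_iff_exists.1 (by simpa using hae)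
      exact hp.2 (p.fst_mem_support_of_mem_edges he)
    refine ⟨?_, fun w => ?_⟩
    · simp [h0]
    · rw [SimpleGraph.Walk.edges_cons, List.countP_cons]
      by_cases hw : w = a
      · subst hw
        rw [h0]
        split_ifs <;> omega
      · by_cases hw' : w = b
        · subst hw'
          split_ifs <;> omega
        · have := h2 w
          simpa [hw, hw'] using this

lemma zmod_two_natCast_eq_one {n : ℕ} : (n : ZMod 2) = 1 ↔ Odd n := ZMod.natCast_eq_one_iff_odd

lemma zmod_two_natCast_eq_zero {n : ℕ} : (n : ZMod 2) = 0 ↔ Even n := ZMod.natCast_eq_zero_iff_even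

lemma sum_single_add_single (s t : V) (S : Finset V) :
    ∑ v ∈ S, (Pi.single s (1 : ZMod 2) + Pi.single t 1 : V → ZMod 2) v =
      (if s ∈ S then 1 else 0) + if t ∈ S then 1 else 0 := by
  simp [Pi.single_apply, Finset.sum_add_distrib]

lemma card_inter_pair {s t : V} (hst : s ≠ t) (S : Finset V) :
    (S ∩ {s, t}).card = (if s ∈ S then 1 else 0) + if t ∈ S then 1 else 0 := by
  by_cases hs : s ∈ S <;> by_cases ht : t ∈ S <;>
    simp [Finset.inter_insert_of_mem, Finset.inter_insert_of_notMem, hs, ht, hst]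

/-- The path crosses every proper nonempty cut, and the number of crossings has the parity of |S ∩
{s, t}|: at least 1 if odd, at least 2 if even. The degree equations follow with the upper bounds 1
and 2 for degrees in a path. -/
lemma lpFeasible_of_isHamiltonian {s t : V} (hst : s ≠ t) {q : (⊤ : SimpleGraph V).Walk s t}
    (hq : q.IsHamiltonian) : LPFeasible s t (fun e => if e ∈ q.edges then (1 : ℝ) else 0) := by
  let Q := q.edges.toFinset
  have hQE : Q ⊆ edges V := by
    intro e he
    have := q.edges_subset_edgeSet (List.mem_toFinset.1 he)
    induction e using Sym2.ind with
    | _ a b => simpa [mk_mem_edges] using this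
  have hnd : q.edges.Nodup := SimpleGraph.Walk.edges_nodup_of_support_nodup hq.isPath.support_nodup
  have hQval : Q.val = (q.edges : Multiset (Sym2 V)) := by
    simp [Q, List.toFinset_val, List.dedup_eq_self.2 hnd]
  have hb : boundary Q = Pi.single s (1 : ZMod 2) + Pi.single t 1 := by
    rw [← multiBoundary_val hQE, hQval, multiBoundary_walk_edges]
  have hsum : ∀ S, ∑ e ∈ cut S, (if e ∈ q.edges then (1 : ℝ) else 0) = (cut S ∩ Q).card := by
    intro S
    rw [← Finset.sum_filter, Finset.sum_const, nsmul_eq_mul, mul_one]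
    congr 2
    ext e
    simp [Q]
  have hne : ∀ S : Finset V, S.Nonempty → S ≠ Finset.univ → 0 < (cut S ∩ Q).card := by
    intro S h1 h2
    obtain ⟨e, he, heS⟩ := exists_mem_edges_cut q hq.mem_support h1 h2
    exact Finset.card_pos.2 ⟨e, Finset.mem_inter.2 ⟨heS, List.mem_toFinset.2 he⟩⟩
  have hcount : ∀ v, (cut {v} ∩ Q).card = q.edges.countP (v ∈ ·) := by
    intro v
    rw [card_cut_inter_eq_countP hQE, hQval, Multiset.coe_countP]
  have hpar : ∀ S, ((cut S ∩ Q).card : ZMod 2) = (if s ∈ S then 1 else 0) + if t ∈ S then 1 else 0 := by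
    intro S
    rw [← sum_single_add_single, ← hb]
    exact crossParity_eq_sum_boundary hQE S
  have hpar' : ∀ S, ((cut S ∩ Q).card : ZMod 2) = ((S ∩ {s, t}).card : ℕ) := by
    intro S
    rw [hpar, card_inter_pair hst]
    push_cast
    rfl
  have hle := countP_edges_le_of_isPath hq.isPath
  have hle' := (countP_edges_le_of_isPath hq.isPath.reverse).1
  rw [SimpleGraph.Walk.edges_reverse, List.countP_reverse] at hle'
  constructor
  · rw [hsum]
    have h1 : Odd (cut {s} ∩ Q).card := by
      rw [← zmod_two_natCast_eq_one, hpar]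
      simp [hst.symm]
    have h2 := hle.1
    rw [← hcount] at h2
    have := h1.pos
    exact_mod_cast (by omega : (cut {s} ∩ Q).card = 1)
  · rw [hsum]
    have h1 : Odd (cut {t} ∩ Q).card := by
      rw [← zmod_two_natCast_eq_one, hpar]
      simp [hst]
    rw [← hcount] at hle'
    have := h1.pos
    exact_mod_cast (by omega : (cut {t} ∩ Q).card = 1)
  · intro v hvs hvt
    rw [hsum]
    have h1 : Even (cut {v} ∩ Q).card := by
      rw [← zmod_two_natCast_eq_zero, hpar]
      simp [hvs.symm, hvt.symm]
    have h2 := hle.2 v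
    rw [← hcount] at h2
    have h3 := hne {v} (Finset.singleton_nonempty v) (by
      intro h
      have := Finset.mem_univ s
      rw [← h, Finset.mem_singleton] at this
      exact hvs this.symm)
    obtain ⟨k, hk⟩ := h1
    exact_mod_cast (by omega : (cut {v} ∩ Q).card = 2)
  · intro S hS
    rw [hsum]
    have h1 : Odd (cut S ∩ Q).card := by
      rw [← zmod_two_natCast_eq_one, hpar', hS]
      simp
    exact_mod_cast h1.pos
  · intro S h1 h2 h3
    rw [hsum]
    have h4 : Even (cut S ∩ Q).card := by
      rwa [← zmod_two_natCast_eq_zero, hpar', zmod_two_natCast_eq_zero]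
    have h5 := hne S h1 h2
    obtain ⟨k, hk⟩ := h4
    exact_mod_cast (by omega : 2 ≤ (cut S ∩ Q).card)
  · intro e _
    split_ifs <;> norm_num
  · intro e _
    split_ifs <;> norm_num

lemma lpCost_hamiltonian {s t : V} (c : Sym2 V → ℝ) {q : (⊤ : SimpleGraph V).Walk s t}
    (hq : q.IsHamiltonian) :
    lpCost c (fun e => if e ∈ q.edges then (1 : ℝ) else 0) = walkCost c q := by
  have hnd : q.edges.Nodup := SimpleGraph.Walk.edges_nodup_of_support_nodup hq.isPath.support_nodup
  rw [lpCost, walkCost, ← List.sum_toFinset c hnd]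
  simp only [mul_ite, mul_one, mul_zero]
  rw [← Finset.sum_filter]
  refine Finset.sum_congr ?_ fun _ _ => rfl
  ext e
  simp only [Finset.mem_filter, List.mem_toFinset, and_iff_right_iff_imp]
  intro he
  have := q.edges_subset_edgeSet he
  induction e using Sym2.ind with
  | _ a b => simpa [mk_mem_edges] using this

lemma LPFeasible.congr {s t : V} {x y : Sym2 V → ℝ} (hx : LPFeasible s t x)
    (h : ∀ e ∈ edges V, x e = y e) : LPFeasible s t y := by
  have hcut : ∀ S, ∑ e ∈ cut S, y e = ∑ e ∈ cut S, x e := fun S =>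
    Finset.sum_congr rfl fun e he => (h e (cut_subset_edges S he)).symm
  constructor
  · rw [hcut, hx.deg_s]
  · rw [hcut, hx.deg_t]
  · intro v h1 h2
    rw [hcut, hx.deg v h1 h2]
  · intro S hS
    rw [hcut]
    exact hx.st_cut S hS
  · intro S h1 h2 h3
    rw [hcut]
    exact hx.even_cut S h1 h2 h3
  · exact fun e he => h e he ▸ hx.nonneg e he
  · exact fun e he => h e he ▸ hx.le_one e he

lemma isClosed_lpFeasible (s t : V) : IsClosed {x : Sym2 V → ℝ | LPFeasible s t x} := by
  have : {x : Sym2 V → ℝ | LPFeasible s t x} =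
      {x | ∑ e ∈ cut {s}, x e = 1} ∩ {x | ∑ e ∈ cut {t}, x e = 1} ∩
      (⋂ v, ⋂ (_ : v ≠ s), ⋂ (_ : v ≠ t), {x | ∑ e ∈ cut {v}, x e = 2}) ∩
      (⋂ S : Finset V, ⋂ (_ : (S ∩ {s, t}).card = 1), {x | 1 ≤ ∑ e ∈ cut S, x e}) ∩
      (⋂ S : Finset V, ⋂ (_ : S.Nonempty), ⋂ (_ : S ≠ Finset.univ),
        ⋂ (_ : Even (S ∩ {s, t}).card), {x | 2 ≤ ∑ e ∈ cut S, x e}) ∩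
      (⋂ e, ⋂ (_ : e ∈ edges V), {x | 0 ≤ x e}) ∩
      (⋂ e, ⋂ (_ : e ∈ edges V), {x | x e ≤ 1}) := by
    ext x
    simp only [Set.mem_inter_iff, Set.mem_iInter, Set.mem_ofPred_eq]
    exact ⟨fun h => ⟨⟨⟨⟨⟨⟨h.1, h.2⟩, h.3⟩, h.4⟩, h.5⟩, h.6⟩, h.7⟩,
      fun ⟨⟨⟨⟨⟨⟨h1, h2⟩, h3⟩, h4⟩, h5⟩, h6⟩, h7⟩ => ⟨h1, h2, h3, h4, h5, h6, h7⟩⟩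
  rw [this]
  refine ((((((isClosed_eq ?_ ?_).inter (isClosed_eq ?_ ?_)).inter ?_).inter ?_).inter ?_).inter
    ?_).inter ?_ <;> try fun_prop
  · exact isClosed_iInter fun v => isClosed_iInter fun _ => isClosed_iInter fun _ =>
      isClosed_eq (by fun_prop) (by fun_prop)
  · exact isClosed_iInter fun v => isClosed_iInter fun _ => isClosed_le (by fun_prop) (by fun_prop)
  · exact isClosed_iInter fun v => isClosed_iInter fun _ => isClosed_iInter fun _ =>
      isClosed_iInter fun _ => isClosed_le (by fun_prop) (by fun_prop)
  · exact isClosed_iInter fun v => isClosed_iInter fun _ => isClosed_le (by fun_prop) (by fun_prop)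
  · exact isClosed_iInter fun v => isClosed_iInter fun _ => isClosed_le (by fun_prop) (by fun_prop)

lemma exists_isLPOptimal {s t : V} (hst : s ≠ t) (c : Sym2 V → ℝ) :
    ∃ x, IsLPOptimal c s t x := by
  -- Diagonal values are unconstrained, so the feasible region is unbounded; zeroing them changes
  -- neither feasibility nor cost and gives compactness.
  let r : (Sym2 V → ℝ) → Sym2 V → ℝ := fun y e => if e ∈ edges V then y e else 0
  have hr : ∀ y, ∀ e ∈ edges V, y e = r y e := fun y e he => (if_pos he).symm
  let K : Set (Sym2 V → ℝ) := (Set.univ.pi fun _ => Set.Icc 0 1) ∩ {x | LPFeasible s t x}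
  have hK : IsCompact K :=
    (isCompact_univ_pi fun _ => isCompact_Icc).inter_right (isClosed_lpFeasible s t)
  have hmem : ∀ y, LPFeasible s t y → r y ∈ K := by
    refine fun y hy => ⟨fun e _ => ?_, hy.congr (hr y)⟩
    by_cases he : e ∈ edges V
    · simp only [r, if_pos he]
      exact ⟨hy.nonneg e he, hy.le_one e he⟩
    · simp [r, he]
  obtain ⟨q, hq⟩ := exists_isHamiltonian hst
  obtain ⟨x, hx, hmin⟩ := hK.exists_isMinOn ⟨_, hmem _ (lpFeasible_of_isHamiltonian hst hq)⟩
    (f := lpCost c) (by unfold lpCost; fun_prop)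
  refine ⟨x, hx.2, fun y hy => (hmin (hmem y hy)).trans_eq ?_⟩
  exact Finset.sum_congr rfl fun e he => by rw [← hr y e he]

/-! ### A fractional version of Hall's theorem -/

/-- If every set `I` of indices has at least `#I` units of capacity in the union of its sets, then
the capacities `x` can be distributed so that every set receives at least one unit. -/
theorem exists_fractional_assignment {ι E : Type*} [Fintype ι] [DecidableEq ι] [Fintype E]
    [DecidableEq E] (C : ι → Finset E) (x : E → ℝ) (hx : ∀ e, 0 ≤ x e)
    (hall : ∀ I : Finset ι, (I.card : ℝ) ≤ ∑ e ∈ I.biUnion C, x e) :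
    ∃ f : ι → E → ℝ, (∀ i e, 0 ≤ f i e) ∧ (∀ e, ∑ i, f i e ≤ x e) ∧
      ∀ i, 1 ≤ ∑ e ∈ C i, f i e := by
  let D : Set (ι → E → ℝ) := (Set.univ.pi fun _ => Set.univ.pi fun e => Set.Icc 0 (x e)) ∩
    ⋂ e, {f | ∑ i, f i e ≤ x e}
  have hD : IsCompact D := by
    refine (isCompact_univ_pi fun _ => isCompact_univ_pi fun _ => isCompact_Icc).inter_right ?_
    exact isClosed_iInter fun e => isClosed_le (by fun_prop) (by fun_prop)
  have hDconv : Convex ℝ D := by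
    refine (convex_pi fun _ _ => convex_pi fun _ _ => convex_Icc _ _).inter
      (convex_iInter fun e => ?_)
    refine convex_halfSpace_le ⟨fun f g => ?_, fun r f => ?_⟩ _
    · simp [Finset.sum_add_distrib]
    · simp [Finset.mul_sum]
  have hmem : ∀ f : ι → E → ℝ, (∀ i e, 0 ≤ f i e) → (∀ e, ∑ i, f i e ≤ x e) → f ∈ D := by
    refine fun f h1 h2 => ⟨fun i _ e _ => ⟨h1 i e, ?_⟩, Set.mem_iInter.2 h2⟩
    exact (Finset.single_le_sum (fun i _ => h1 i e) (Finset.mem_univ i)).trans (h2 e)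
  let T : (ι → E → ℝ) →ₗ[ℝ] (ι → ℝ) :=
    { toFun := fun f i => ∑ e ∈ C i, f i e
      map_add' := fun f g => by ext i; simp [Finset.sum_add_distrib]
      map_smul' := fun r f => by ext i; simp [Finset.mul_sum] }
  have hT : Continuous T := T.continuous_of_finiteDimensional
  by_contra hcon
  have hdisj : Disjoint (T '' D) {z : ι → ℝ | ∀ i, 1 ≤ z i} := by
    rw [Set.disjoint_left]
    rintro _ ⟨f, hf, rfl⟩ hz
    exact hcon ⟨f, fun i e => (hf.1 i trivial e trivial).1, Set.mem_iInter.1 hf.2, hz⟩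
  have hclosed : IsClosed {z : ι → ℝ | ∀ i, 1 ≤ z i} := by
    simp only [Set.ofPred_forall]
    exact isClosed_iInter fun i => isClosed_le (by fun_prop) (by fun_prop)
  have hconv : Convex ℝ {z : ι → ℝ | ∀ i, 1 ≤ z i} := by
    simp only [Set.ofPred_forall]
    exact convex_iInter fun i => convex_halfSpace_ge ⟨fun _ _ => rfl, fun _ _ => rfl⟩ _
  obtain ⟨φ, u, v, hu, huv, hv⟩ := geometric_hahn_banach_compact_closed (hDconv.linear_image T)
    (hD.image hT) hconv hclosed hdisj
  let w : ι → ℝ := fun i => φ (Pi.single i 1)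
  have hφ : ∀ z : ι → ℝ, φ z = ∑ i, w i * z i := by
    intro z
    have h1 := LinearMap.pi_apply_eq_sum_univ φ.toLinearMap z
    refine h1.trans (Finset.sum_congr rfl fun i _ => ?_)
    have h2 : (fun j => if i = j then (1 : ℝ) else 0) = Pi.single i 1 := by
      ext j
      simp [Pi.single_apply, eq_comm]
    rw [smul_eq_mul, mul_comm, h2]
    rfl
  -- The set on the right is closed under increasing coordinates; with a negative weight, moving far
  -- enough along that coordinate would bring `φ` down to `v`.
  have hw : ∀ i, 0 ≤ w i := by
    intro i
    by_contra! hneg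
    have h1 := hv (fun _ => 1) (fun _ => le_rfl)
    have hr : 0 ≤ (v - φ fun _ => 1) / w i :=
      div_nonneg_of_nonpos (by linarith) hneg.le
    have h2 := hv ((fun _ => 1) + ((v - φ fun _ => 1) / w i) • Pi.single i 1) (fun j => by
      simp only [Pi.add_apply, Pi.smul_apply, smul_eq_mul, Pi.single_apply]
      split_ifs <;> linarith)
    rw [map_add, map_smul, smul_eq_mul] at h2
    have h3 : (v - φ fun _ => 1) / w i * φ (Pi.single i 1) = v - φ fun _ => 1 :=
      div_mul_cancel₀ _ hneg.ne
    linarith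
  -- The assignment that maximizes `φ` gives all of `e` to a heaviest index whose set contains `e`.
  have hp : ∀ e, ∃ p : ι → ℝ, (∀ i, 0 ≤ p i) ∧ ∑ i, p i ≤ 1 ∧
      ∀ i, e ∈ C i → w i ≤ ∑ k, if e ∈ C k then w k * p k else 0 := by
    intro e
    rcases (Finset.univ.filter fun i => e ∈ C i).eq_empty_or_nonempty with h | h
    · refine ⟨fun _ => 0, by simp, by simp, fun i hi => ?_⟩
      exact absurd (h ▸ Finset.mem_filter.2 ⟨Finset.mem_univ i, hi⟩) (Finset.notMem_empty i)
    · obtain ⟨j, hj, hmax⟩ := Finset.exists_max_image _ w h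
      refine ⟨Pi.single j 1, fun i => ?_, by simp, fun i hi => ?_⟩
      · rw [Pi.single_apply]
        split_ifs <;> norm_num
      · refine (hmax i (by simpa using hi)).trans_eq ?_
        rw [Finset.sum_eq_single j]
        · simp [(Finset.mem_filter.1 hj).2]
        · intro k _ hk
          simp [hk]
        · simp
  choose p hp0 hp1 hpmax using hp
  let g : E → ℝ := fun e => ∑ k, if e ∈ C k then w k * p e k else 0
  have hg : ∀ e, 0 ≤ g e := fun e => Finset.sum_nonneg fun k _ => by
    split_ifs
    exacts [mul_nonneg (hw k) (hp0 e k), le_rfl]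
  -- The sets of all indices of weight at least `θ` consist of elements with `g` at least `θ`. So
  -- Hall's condition is the superlevel condition on the disjoint union, with mass -1 on indices and
  -- `x` on elements.
  have key := sum_mul_nonneg_of_superlevel Finset.univ (Sum.elim w g) (Sum.elim (fun _ => -1) x)
    (by rintro (i | e) _ <;> simp [hw, hg]) (by
      intro θ hθ
      rw [Finset.sum_filter, Fintype.sum_sum_type]
      change 0 ≤ (∑ i, if θ ≤ w i then (-1 : ℝ) else 0) + ∑ e, if θ ≤ g e then x e else 0
      rw [← Finset.sum_filter, ← Finset.sum_filter, Finset.sum_const, nsmul_eq_mul]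
      have h1 := hall (Finset.univ.filter fun i => θ ≤ w i)
      have h2 : ∑ e ∈ (Finset.univ.filter fun i => θ ≤ w i).biUnion C, x e ≤
          ∑ e with θ ≤ g e, x e := by
        refine Finset.sum_le_sum_of_subset_of_nonneg ?_ fun e _ _ => hx e
        intro e he
        simp only [Finset.mem_biUnion, Finset.mem_filter, Finset.mem_univ, true_and] at he ⊢
        obtain ⟨i, hi, hie⟩ := he
        exact hi.trans (hpmax e i hie)
      linarith)
  rw [Fintype.sum_sum_type] at key
  simp only [Sum.elim_inl, Sum.elim_inr] at key
  let f : ι → E → ℝ := fun i e => x e * p e i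
  have hf : f ∈ D := by
    refine hmem f (fun i e => mul_nonneg (hx e) (hp0 e i)) fun e => ?_
    simp only [f, ← Finset.mul_sum]
    exact mul_le_of_le_one_right (hx e) (hp1 e)
  have h1 := hu _ ⟨f, hf, rfl⟩
  have h2 := hv (fun _ => 1) (fun _ => le_rfl)
  have h3 : φ (T f) = ∑ e, g e * x e := by
    rw [hφ]
    simp only [T, f, g, LinearMap.coe_mk, AddHom.coe_mk, Finset.mul_sum, Finset.sum_mul]
    conv_rhs => rw [Finset.sum_comm]
    refine Finset.sum_congr rfl fun i _ => ?_
    simp only [ite_mul, zero_mul]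
    rw [← Finset.sum_filter, Finset.filter_mem_eq_inter, Finset.univ_inter]
    exact Finset.sum_congr rfl fun e _ => by ring
  rw [hφ] at h2
  rw [h3] at h1
  simp only [mul_neg, mul_one, Finset.sum_neg_distrib] at key h2
  linarith

/-! ### Narrow cuts -/

lemma cut_sdiff_of_subset {A B : Finset V} (h : A ⊆ B) :
    cut (B \ A) = (cut B \ cut A) ∪ (cut A \ cut B) := by
  ext e
  induction e using Sym2.ind with
  | _ a b =>
    have ha := @h a
    have hb := @h b
    simp only [Finset.mem_union, Finset.mem_sdiff, mk_mem_cut]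
    tauto

/-- The term x(δ(M)) for the largest member carries the induction. Let M' be the next largest, p =
x(δ(M) \ δ(M')) and q = x(δ(M') \ δ(M)). The left side grows by 2 + p - q and the right side by 2p,
and p + q = x(δ(M \ M')) ≥ 2. -/
lemma chain_card_le {s t : V} {x : Sym2 V → ℝ} (hx : LPFeasible s t x) (n : ℕ)
    (𝒩 : Finset (Finset V)) (hn : 𝒩.card = n + 1) (hst : ∀ U ∈ 𝒩, s ∈ U ∧ t ∉ U)
    (M : Finset V) (hM : M ∈ 𝒩) (hchain : ∀ U ∈ 𝒩, ∀ U' ∈ 𝒩, U ⊆ U' ∨ U' ⊆ U)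
    (hmax : ∀ U ∈ 𝒩, U ⊆ M) :
    2 * (n : ℝ) + 1 + ∑ e ∈ cut M, x e ≤ 2 * ∑ e ∈ 𝒩.biUnion cut, x e := by
  induction n generalizing 𝒩 M with
  | zero =>
    have h1 : 𝒩 = {M} := by
      obtain ⟨U, hU⟩ := Finset.card_eq_one.1 hn
      rw [hU, Finset.mem_singleton] at hM
      rw [hU, hM]
    have h2 := hx.st_cut M (by
      obtain ⟨h1, h2⟩ := hst M hM
      simp [Finset.inter_insert_of_mem, h1, h2])
    rw [h1, Finset.singleton_biUnion]
    push_cast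
    linarith
  | succ n ih =>
    have hcard : (𝒩.erase M).card = n + 1 := by
      rw [Finset.card_erase_of_mem hM, hn]
      rfl
    obtain ⟨M', hM', hmax'⟩ := Finset.exists_max_image (𝒩.erase M) Finset.card
      (Finset.card_pos.1 (by omega))
    obtain ⟨hne, hM'N⟩ := Finset.mem_erase.1 hM'
    have hsub : ∀ U ∈ 𝒩.erase M, U ⊆ M' := by
      intro U hU
      rcases hchain U (Finset.mem_of_mem_erase hU) M' hM'N with h | h
      · exact h
      · exact (Finset.eq_of_subset_of_card_le h (hmax' U hU)).ge
    have h1 := ih (𝒩.erase M) hcard (fun U hU => hst U (Finset.mem_of_mem_erase hU)) M' hM'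
      (fun U hU U' hU' => hchain U (Finset.mem_of_mem_erase hU) U' (Finset.mem_of_mem_erase hU'))
      hsub
    have hM'M := hmax M' hM'N
    have hL := hx.even_cut (M \ M') (by
        rw [Finset.sdiff_nonempty]
        exact fun h => hne (Finset.Subset.antisymm hM'M h))
      (by
        intro h
        have := Finset.mem_univ s
        rw [← h, Finset.mem_sdiff] at this
        exact this.2 (hst M' hM'N).1)
      (by
        have h1 := hst M hM
        have h2 := hst M' hM'N
        have : (M \ M') ∩ {s, t} = ∅ := by
          ext v
          simp only [Finset.mem_inter, Finset.mem_sdiff, Finset.mem_insert, Finset.mem_singleton,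
            Finset.notMem_empty, iff_false]
          rintro ⟨⟨h3, h4⟩, rfl | rfl⟩
          · exact h4 h2.1
          · exact h1.2 h3
        rw [this]
        simp)
    rw [cut_sdiff_of_subset hM'M, Finset.sum_union disjoint_sdiff_sdiff] at hL
    have h2 := Finset.sum_inter_add_sum_sdiff (cut M) (cut M') x
    have h3 := Finset.sum_inter_add_sum_sdiff (cut M') (cut M) x
    rw [Finset.inter_comm] at h3
    have h4 : ∑ e ∈ 𝒩.biUnion cut, x e =
        ∑ e ∈ (𝒩.erase M).biUnion cut, x e + ∑ e ∈ cut M \ cut M', x e := by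
      rw [← Finset.sum_union]
      · refine Finset.sum_congr ?_ fun _ _ => rfl
        conv_lhs => rw [← Finset.insert_erase hM, Finset.biUnion_insert]
        ext e
        have : e ∈ cut M' → e ∈ (𝒩.erase M).biUnion cut := fun h =>
          Finset.mem_biUnion.2 ⟨M', hM', h⟩
        simp only [Finset.mem_union, Finset.mem_sdiff]
        tauto
      · rw [Finset.disjoint_left]
        intro e he he'
        obtain ⟨U, hU, heU⟩ := Finset.mem_biUnion.1 he
        have hUM' := hsub U hU
        induction e using Sym2.ind with
        | _ a b =>
          simp only [Finset.mem_sdiff, mk_mem_cut] at he' heU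
          have ha := @hUM' a
          have hb := @hUM' b
          have ha' := @hM'M a
          have hb' := @hM'M b
          tauto
    rw [h4]
    push_cast
    linarith

/-- Hall's condition for the narrow cuts. -/
lemma card_le_sum_biUnion_cut {s t : V} {x : Sym2 V → ℝ} (hx : LPFeasible s t x)
    (𝒩 : Finset (Finset V)) (hst : ∀ U ∈ 𝒩, s ∈ U ∧ t ∉ U)
    (hchain : ∀ U ∈ 𝒩, ∀ U' ∈ 𝒩, U ⊆ U' ∨ U' ⊆ U) :
    (𝒩.card : ℝ) ≤ ∑ e ∈ 𝒩.biUnion cut, x e := by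
  rcases 𝒩.eq_empty_or_nonempty with rfl | hne
  · simp
  obtain ⟨M, hM, hmax⟩ := Finset.exists_max_image 𝒩 Finset.card hne
  obtain ⟨n, hn⟩ := Nat.exists_eq_succ_of_ne_zero (Finset.card_pos.2 hne).ne'
  have h1 := chain_card_le hx n 𝒩 hn hst M hM hchain (by
    intro U hU
    rcases hchain U hU M hM with h | h
    · exact h
    · exact (Finset.eq_of_subset_of_card_le h (hmax U hU)).ge)
  have h2 := hx.st_cut M (by
    obtain ⟨h1, h2⟩ := hst M hM
    simp [Finset.inter_insert_of_mem, h1, h2])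
  rw [hn]
  push_cast
  linarith

/-- Posimodularity of the cut function, checked edge by edge. -/
lemma sum_cut_sdiff_add_le {x : Sym2 V → ℝ} (hx : ∀ e ∈ edges V, 0 ≤ x e) (A B : Finset V) :
    ∑ e ∈ cut (A \ B), x e + ∑ e ∈ cut (B \ A), x e ≤ ∑ e ∈ cut A, x e + ∑ e ∈ cut B, x e := by
  have hind : ∀ S : Finset V, ∑ e ∈ cut S, x e =
      ∑ e ∈ edges V, (if e ∈ cut S then 1 else 0) * x e := by
    intro S
    simp only [ite_mul, one_mul, zero_mul]
    rw [← Finset.sum_filter, Finset.filter_mem_eq_inter,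
      Finset.inter_eq_right.2 (cut_subset_edges S)]
  simp only [hind, ← Finset.sum_add_distrib, ← add_mul]
  refine Finset.sum_le_sum fun e he => mul_le_mul_of_nonneg_right ?_ (hx e he)
  clear he
  induction e using Sym2.ind with
  | _ a b =>
    simp only [mk_mem_cut, Finset.mem_sdiff]
    by_cases h1 : a ∈ A <;> by_cases h2 : a ∈ B <;> by_cases h3 : b ∈ A <;> by_cases h4 : b ∈ B <;>
      simp [h1, h2, h3, h4]

/-- Cuts of value less than two that separate `s` from `t` form a chain. -/
lemma narrow_chain {s t : V} {x : Sym2 V → ℝ} (hx : LPFeasible s t x) {A B : Finset V}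
    (hA : s ∈ A ∧ t ∉ A) (hB : s ∈ B ∧ t ∉ B) (hA2 : ∑ e ∈ cut A, x e < 2)
    (hB2 : ∑ e ∈ cut B, x e < 2) : A ⊆ B ∨ B ⊆ A := by
  by_contra! h
  -- For crossing sets both differences avoid `s` and `t`, so their cuts have total value at least
  -- 4, more than `A` and `B` together.
  have haux : ∀ A B : Finset V, (s ∈ A ∧ t ∉ A) → (s ∈ B ∧ t ∉ B) → ¬ A ⊆ B →
      2 ≤ ∑ e ∈ cut (A \ B), x e := by
    intro A B hA hB h
    refine hx.even_cut _ (Finset.sdiff_nonempty.2 h) ?_ ?_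
    · intro h
      have := Finset.mem_univ s
      rw [← h, Finset.mem_sdiff] at this
      exact this.2 hB.1
    · have : (A \ B) ∩ {s, t} = ∅ := by
        ext v
        simp only [Finset.mem_inter, Finset.mem_sdiff, Finset.mem_insert, Finset.mem_singleton,
          Finset.notMem_empty, iff_false]
        rintro ⟨⟨h3, h4⟩, rfl | rfl⟩
        · exact h4 hB.1
        · exact hA.2 h3
      rw [this]
      simp
  have h1 := sum_cut_sdiff_add_le hx.nonneg A B
  linarith [haux A B hA hB h.1, haux B A hB hA h.2]

/-- The capacities `x` can be split among a chain of `s`-`t` cuts. -/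
lemma exists_narrow_assignment {s t : V} {x : Sym2 V → ℝ} (hx : LPFeasible s t x)
    (𝒩 : Finset (Finset V)) (hst : ∀ U ∈ 𝒩, s ∈ U ∧ t ∉ U)
    (hchain : ∀ U ∈ 𝒩, ∀ U' ∈ 𝒩, U ⊆ U' ∨ U' ⊆ U) :
    ∃ f : 𝒩 → Sym2 V → ℝ, (∀ U e, 0 ≤ f U e) ∧ (∀ e ∈ edges V, ∑ U, f U e ≤ x e) ∧
      ∀ U, 1 ≤ ∑ e ∈ cut U.1, f U e := by
  obtain ⟨f, h1, h2, h3⟩ := exists_fractional_assignment (fun U : 𝒩 => cut U.1)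
    (fun e => if e ∈ edges V then x e else 0) (fun e => by
      split_ifs with he
      exacts [hx.nonneg e he, le_rfl]) (fun I => by
      have h1 := card_le_sum_biUnion_cut hx (I.image Subtype.val)
        (fun U hU => by
          obtain ⟨U', -, rfl⟩ := Finset.mem_image.1 hU
          exact hst _ U'.2)
        (fun U hU U' hU' => by
          obtain ⟨W, -, rfl⟩ := Finset.mem_image.1 hU
          obtain ⟨W', -, rfl⟩ := Finset.mem_image.1 hU'
          exact hchain _ W.2 _ W'.2)
      rw [Finset.card_image_of_injective _ Subtype.val_injective, Finset.image_biUnion] at h1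
      refine h1.trans_eq (Finset.sum_congr rfl fun e he => (if_pos ?_).symm)
      obtain ⟨U, -, hU⟩ := Finset.mem_biUnion.1 he
      exact cut_subset_edges _ hU)
  exact ⟨f, h1, fun e he => by simpa [he] using h2 e, h3⟩

/-! ### Decomposition of the feasible points -/

lemma sum_indicator_mul {A B : Finset (Sym2 V)} (h : A ⊆ B) (x : Sym2 V → ℝ) :
    ∑ e ∈ B, (if e ∈ A then 1 else 0) * x e = ∑ e ∈ A, x e := by
  simp only [ite_mul, one_mul, zero_mul]
  rw [← Finset.sum_filter, Finset.filter_mem_eq_inter, Finset.inter_eq_right.2 h]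

lemma inside_subset_edges (S : Finset V) : inside S ⊆ edges V := Finset.filter_subset _ _

lemma sum_degree_eq (x : Sym2 V → ℝ) (S : Finset V) :
    ∑ v ∈ S, ∑ e ∈ cut {v}, x e = 2 * ∑ e ∈ inside S, x e + ∑ e ∈ cut S, x e := by
  have h1 : ∀ v, ∑ e ∈ cut {v}, x e =
      ∑ e ∈ edges V, (if e ∈ cut {v} then 1 else 0) * x e := fun v =>
    (sum_indicator_mul (cut_subset_edges _) x).symm
  rw [← sum_indicator_mul (cut_subset_edges S), ← sum_indicator_mul (inside_subset_edges S),
    Finset.sum_congr rfl fun v _ => h1 v, Finset.sum_comm, Finset.mul_sum,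
    ← Finset.sum_add_distrib]
  refine Finset.sum_congr rfl fun e he => ?_
  rw [← Finset.sum_mul, ← mul_assoc, ← add_mul]
  congr 1
  induction e using Sym2.ind with
  | _ a b =>
    rw [mk_mem_edges] at he
    have h2 : ∀ v, (if s(a, b) ∈ cut {v} then (1 : ℝ) else 0) =
        (if v = a then 1 else 0) + (if v = b then 1 else 0) := by
      intro w
      simp only [mk_mem_cut, Finset.mem_singleton]
      by_cases h1 : w = a <;> by_cases h2 : w = b <;> grind
    rw [Finset.sum_congr rfl fun v _ => h2 v, Finset.sum_add_distrib, Finset.sum_ite_eq',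
      Finset.sum_ite_eq']
    by_cases h3 : a ∈ S <;> by_cases h4 : b ∈ S <;>
      simp [mk_mem_cut, mk_mem_inside, h3, h4, he, one_add_one_eq_two]

lemma LPFeasible.sum_degree {s t : V} (hst : s ≠ t) {x : Sym2 V → ℝ} (hx : LPFeasible s t x)
    (S : Finset V) : ∑ v ∈ S, ∑ e ∈ cut {v}, x e = 2 * S.card - (S ∩ {s, t}).card := by
  have h : ∀ v, ∑ e ∈ cut {v}, x e = 2 - (if v = s then 1 else 0) - if v = t then 1 else 0 := by
    intro v
    by_cases h1 : v = s
    · subst h1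
      rw [hx.deg_s]
      simp [hst]
      norm_num
    · by_cases h2 : v = t
      · subst h2
        rw [hx.deg_t]
        simp [h1]
        norm_num
      · rw [hx.deg v h1 h2]
        simp [h1, h2]
  rw [Finset.sum_congr rfl fun v _ => h v, Finset.sum_sub_distrib, Finset.sum_sub_distrib,
    Finset.sum_ite_eq', Finset.sum_ite_eq', Finset.sum_const, card_inter_pair hst]
  push_cast
  rw [nsmul_eq_mul]
  ring

lemma LPFeasible.sum_edges {s t : V} (hst : s ≠ t) {x : Sym2 V → ℝ} (hx : LPFeasible s t x) :
    ∑ e ∈ edges V, x e = Fintype.card V - 1 := by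
  have h1 := hx.sum_degree hst Finset.univ
  rw [sum_degree_eq] at h1
  have h2 : inside (Finset.univ : Finset V) = edges V := by simp [inside]
  have h3 : cut (Finset.univ : Finset V) = ∅ := by simp [cut]
  rw [h2, h3, card_inter_pair hst] at h1
  simp only [Finset.sum_empty, Finset.card_univ, Finset.mem_univ, if_true] at h1
  push_cast at h1
  linarith

/-- By counting degrees, 2x(inside S) = 2|S| - |S ∩ {s, t}| - x(δ(S)), and the cut constraints make
the subtracted part at least 2 when S is proper. -/
lemma LPFeasible.sum_inside_le {s t : V} (hst : s ≠ t) {x : Sym2 V → ℝ} (hx : LPFeasible s t x)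
    {S : Finset V} (hS : S.Nonempty) : ∑ e ∈ inside S, x e ≤ S.card - 1 := by
  by_cases huniv : S = Finset.univ
  · subst huniv
    have h2 : inside (Finset.univ : Finset V) = edges V := by simp [inside]
    rw [h2, hx.sum_edges hst, Finset.card_univ]
  · have h1 := hx.sum_degree hst S
    rw [sum_degree_eq] at h1
    rcases Nat.even_or_odd (S ∩ {s, t}).card with h | h
    · have h2 := hx.even_cut S hS huniv h
      have h3 : (0 : ℝ) ≤ (S ∩ {s, t}).card := by positivity
      linarith
    · have h3 : (S ∩ {s, t}).card = 1 := by
        have : (S ∩ {s, t}).card ≤ 2 :=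
          (Finset.card_le_card Finset.inter_subset_right).trans Finset.card_le_two
        obtain ⟨k, hk⟩ := h
        omega
      have h2 := hx.st_cut S h3
      rw [h3] at h1
      push_cast at h1
      linarith

lemma LPFeasible.nonempty_treeDecomposition {s t : V} (hst : s ≠ t) {x : Sym2 V → ℝ}
    (hx : LPFeasible s t x) : Nonempty (TreeDecomposition x) := by
  have : Nonempty V := ⟨s⟩
  have hy := hx.congr (y := fun e => if e ∈ edges V then x e else 0) fun e he => (if_pos he).symm
  exact nonempty_treeDecomposition_of_mem_convexHull
    (mem_convexHull_isSpanningTree hy.nonneg (fun e he => if_neg he) (hy.sum_edges hst)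
      fun S hS => hy.sum_inside_le hst hS) fun e he => if_pos he

/-! ### The remaining steps of the algorithm -/

/-- Over `ZMod 2` the wrong degree set is the boundary of `J` corrected by `s + t`, which turns
T-joins into a linear condition. -/
lemma mem_wrongDegree_indicator {s t : V} (hst : s ≠ t) (J : Finset (Sym2 V)) (v : V) :
    (boundary J + (Pi.single s 1 + Pi.single t 1) : V → ZMod 2) v = 1 ↔ v ∈ wrongDegree s t J := by
  simp only [wrongDegree, Finset.mem_filter, Finset.mem_univ, true_and, Pi.add_apply,
    Pi.single_apply, boundary, crossParity]
  by_cases h : v = s ∨ v = t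
  · have h1 : ((if v = s then 1 else 0) + if v = t then 1 else 0 : ZMod 2) = 1 := by
      rcases h with rfl | rfl
      · simp [hst]
      · simp [hst.symm]
    rw [h1, if_pos h, ← zmod_two_natCast_eq_zero, add_eq_right]
  · have h1 := not_or.1 h
    rw [if_neg h, if_neg h1.1, if_neg h1.2, add_zero, add_zero, zmod_two_natCast_eq_one]

lemma zmod_two_eq_of_eq_one_iff {a b : ZMod 2} (h : a = 1 ↔ b = 1) : a = b := by
  revert a b
  decide

lemma isTJoin_wrongDegree_iff {s t : V} (hst : s ≠ t) (J F : Finset (Sym2 V)) :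
    IsTJoin (wrongDegree s t J) F ↔ F ⊆ edges V ∧
      boundary F = boundary J + (Pi.single s (1 : ZMod 2) + Pi.single t 1) := by
  refine and_congr_right fun _ => ?_
  simp only [← mem_wrongDegree_indicator hst, ← zmod_two_natCast_eq_one]
  exact ⟨fun h => funext fun v => zmod_two_eq_of_eq_one_iff (h v), fun h v => by rw [← h]; rfl⟩

lemma isMinTJoin_wrongDegree_iff {s t : V} (hst : s ≠ t) (c : Sym2 V → ℝ)
    (J F : Finset (Sym2 V)) : IsMinTJoin c (wrongDegree s t J) F ↔
      IsMinJoin c (boundary J + (Pi.single s (1 : ZMod 2) + Pi.single t 1)) F := by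
  simp only [IsMinTJoin, isTJoin_wrongDegree_iff hst]
  exact ⟨fun ⟨⟨h1, h2⟩, h3⟩ => ⟨h1, h2, fun F' h4 h5 => h3 F' ⟨h4, h5⟩⟩,
    fun ⟨h1, h2, h3⟩ => ⟨⟨h1, h2⟩, fun F' h4 => h3 F' h4.1 h4.2⟩⟩

lemma exists_boundary_eq {s t : V} (hst : s ≠ t) {J : Finset (Sym2 V)} (hJ : J ⊆ edges V) :
    ∃ F ⊆ edges V, boundary F = boundary J + (Pi.single s (1 : ZMod 2) + Pi.single t 1) := by
  refine ⟨symmDiff J {s(s, t)}, symmDiff_subset_edges hJ (by simpa [mk_mem_edges] using hst), ?_⟩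
  rw [boundary_symmDiff, boundary_singleton hst]

lemma exists_isMinTJoin {s t : V} (hst : s ≠ t) (c : Sym2 V → ℝ) {J : Finset (Sym2 V)}
    (hJ : J ⊆ edges V) : ∃ F, IsMinTJoin c (wrongDegree s t J) F := by
  simp only [isMinTJoin_wrongDegree_iff hst]
  exact exists_isMinJoin c (exists_boundary_eq hst hJ)

lemma exists_isEulerianTraversal {s t : V} (hst : s ≠ t) {J F : Finset (Sym2 V)}
    (hJ : IsSpanningTree J) (hF : IsTJoin (wrongDegree s t J) F) :
    ∃ w : (⊤ : SimpleGraph V).Walk s t, IsEulerianTraversal J F w := by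
  obtain ⟨hFE, hFb⟩ := (isTJoin_wrongDegree_iff hst J F).1 hF
  refine exists_eulerian_walk (J.val + F.val) (fun e he => ?_) s t ?_ fun S h1 h2 => ?_
  · rcases Multiset.mem_add.1 he with h | h
    exacts [hJ.1 h, hFE h]
  · rw [multiBoundary_add, multiBoundary_val hJ.1, multiBoundary_val hFE, hFb]
    linear_combination add_self_zmod_two (boundary J)
  · obtain ⟨e, he, heS⟩ := hJ.exists_mem_cut h1 h2
    exact ⟨e, Multiset.mem_add.2 (Or.inl he), heS⟩

lemma IsEulerianTraversal.mem_support {s t : V} (hst : s ≠ t) {J F : Finset (Sym2 V)}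
    (hJ : IsSpanningTree J) {w : (⊤ : SimpleGraph V).Walk s t} (hw : IsEulerianTraversal J F w)
    (v : V) : v ∈ w.support := by
  obtain ⟨e, he, hev⟩ := hJ.exists_mem_cut (Finset.singleton_nonempty v) (by
    intro h
    have h1 := Finset.mem_univ s
    have h2 := Finset.mem_univ t
    rw [← h, Finset.mem_singleton] at h1 h2
    exact hst (h1.trans h2.symm))
  obtain ⟨a, b, ha, -, rfl⟩ := exists_of_mem_cut hev
  rw [Finset.mem_singleton] at ha
  subst ha
  have : s(a, b) ∈ (w.edges : Multiset (Sym2 V)) := by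
    rw [hw]
    exact Multiset.mem_add.2 (Or.inl he)
  exact w.fst_mem_support_of_mem_edges (Multiset.mem_coe.1 this)

/-! ### The expected cost -/

lemma TreeDecomposition.expectation_card_cut {x : Sym2 V → ℝ} (D : TreeDecomposition x)
    (S : Finset V) :
    ∑ i, D.coeff i * ((cut S ∩ D.tree i).card : ℝ) = ∑ e ∈ cut S, x e := by
  rw [← Finset.sum_congr rfl fun e he => D.sum_eq e (cut_subset_edges S he), Finset.sum_comm]
  refine Finset.sum_congr rfl fun i _ => ?_
  rw [← Finset.mul_sum, ← Finset.sum_filter, Finset.filter_mem_eq_inter, Finset.sum_const,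
    nsmul_eq_mul, mul_one]

/-- A fractional join for the wrong degree vertices of a spanning tree `J`: a combination of `J`,
of the relaxation `x` and of the corrections `f U` for the narrow cuts `U` that `J` crosses more
than once. -/
lemma correction_covers {s t : V} (hst : s ≠ t) {x : Sym2 V → ℝ} (hx : LPFeasible s t x)
    {α β τ : ℝ} (hα : 0 ≤ α) (hβ : 0 ≤ β) (h1 : α + 2 * β = 1) (h2 : 2 * α + β * τ = 1)
    {𝒩 : Finset (Finset V)}
    (h𝒩 : ∀ U, U ∈ 𝒩 ↔ s ∈ U ∧ t ∉ U ∧ ∑ e ∈ cut U, x e < τ) {f : 𝒩 → Sym2 V → ℝ}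
    (hf : ∀ U e, 0 ≤ f U e) (hf1 : ∀ U, 1 ≤ ∑ e ∈ cut U.1, f U e) {J : Finset (Sym2 V)}
    (hJ : IsSpanningTree J) {κ : 𝒩 → ℝ}
    (hκ : ∀ U, κ U = ((cut U.1 ∩ J).card - 1) * (β * (τ - ∑ e ∈ cut U.1, x e)))
    {y : Sym2 V → ℝ}
    (hy : ∀ e, y e = α * (if e ∈ J then 1 else 0) + β * x e +
      ∑ U, κ U * f U e) :
    (∀ e ∈ edges V, 0 ≤ y e) ∧ ∀ S : Finset V,
      ∑ v ∈ S, (boundary J + (Pi.single s 1 + Pi.single t 1) : V → ZMod 2) v = 1 →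
        1 ≤ ∑ e ∈ cut S, y e := by
  have hne : ∀ S : Finset V, S.Nonempty → S ≠ Finset.univ → 1 ≤ (cut S ∩ J).card := by
    intro S h1 h2
    obtain ⟨e, he, heS⟩ := hJ.exists_mem_cut h1 h2
    exact Finset.card_pos.2 ⟨e, Finset.mem_inter.2 ⟨heS, he⟩⟩
  have hne' : ∀ U : Finset V, s ∈ U → t ∉ U → 1 ≤ (cut U ∩ J).card := by
    refine fun U hs ht => hne U ⟨s, hs⟩ fun h => ht ?_
    rw [h]
    exact Finset.mem_univ t
  have hcoeff : ∀ U, 0 ≤ κ U := by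
    intro U
    rw [hκ]
    obtain ⟨hs, ht, hlt⟩ := (h𝒩 U.1).1 U.2
    have h1 : (1 : ℝ) ≤ (cut U.1 ∩ J).card := by exact_mod_cast hne' U.1 hs ht
    exact mul_nonneg (sub_nonneg.2 h1) (mul_nonneg hβ (sub_nonneg.2 hlt.le))
  have hcorr : ∀ e, 0 ≤ ∑ U, κ U * f U e :=
    fun e => Finset.sum_nonneg fun U _ => mul_nonneg (hcoeff U) (hf U e)
  have hysum : ∀ S, ∑ e ∈ cut S, y e = α * (cut S ∩ J).card + β * ∑ e ∈ cut S, x e +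
      ∑ e ∈ cut S, ∑ U, κ U * f U e := by
    intro S
    simp only [hy, Finset.sum_add_distrib, ← Finset.mul_sum]
    rw [← Finset.sum_filter, Finset.filter_mem_eq_inter, Finset.sum_const, nsmul_eq_mul, mul_one]
  refine ⟨fun e he => ?_, ?_⟩
  · rw [hy]
    have h3 := hx.nonneg e he
    have h4 := hcorr e
    have h5 : (0 : ℝ) ≤ if e ∈ J then 1 else 0 := by split_ifs <;> norm_num
    positivity
  have hsep : ∀ S : Finset V, s ∈ S → t ∉ S → Even (cut S ∩ J).card → 1 ≤ ∑ e ∈ cut S, y e := by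
    intro S hs ht heven
    have h3 : 2 ≤ (cut S ∩ J).card := by
      have := hne' S hs ht
      obtain ⟨k, hk⟩ := heven
      omega
    have h3' : (2 : ℝ) ≤ (cut S ∩ J).card := by exact_mod_cast h3
    rw [hysum]
    have h4 : α * 2 ≤ α * (cut S ∩ J).card := mul_le_mul_of_nonneg_left h3' hα
    -- The deficit of a narrow cut is at most β(τ - x(δ(S))). Here `J` crosses at least twice, so
    -- `κ` is at least that, and `f` delivers a full unit of it on this cut.
    by_cases hS : ∑ e ∈ cut S, x e < τ
    · let U : 𝒩 := ⟨S, (h𝒩 S).2 ⟨hs, ht, hS⟩⟩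
      have h5 : β * (τ - ∑ e ∈ cut S, x e) ≤ κ U := by
        rw [hκ]
        exact le_mul_of_one_le_left (mul_nonneg hβ (sub_nonneg.2 hS.le)) (by linarith)
      have h6 : κ U ≤ ∑ e ∈ cut S, κ U * f U e := by
        rw [← Finset.mul_sum]
        exact le_mul_of_one_le_right (hcoeff U) (hf1 U)
      have h7 : ∑ e ∈ cut S, κ U * f U e ≤ ∑ e ∈ cut S, ∑ U, κ U * f U e :=
        Finset.sum_le_sum fun e _ => Finset.single_le_sum (f := fun U => κ U * f U e)
          (fun U _ => mul_nonneg (hcoeff U) (hf U e)) (Finset.mem_univ U)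
      linarith
    · have h5 : β * τ ≤ β * ∑ e ∈ cut S, x e := mul_le_mul_of_nonneg_left (not_lt.1 hS) hβ
      have h6 := Finset.sum_nonneg fun e (_ : e ∈ cut S) => hcorr e
      linarith
  intro S hS
  have hpar : ((cut S ∩ J).card : ZMod 2) +
      ((if s ∈ S then 1 else 0) + if t ∈ S then 1 else 0) = 1 := by
    refine Eq.trans ?_ hS
    rw [← sum_single_add_single]
    simp only [Pi.add_apply, Finset.sum_add_distrib]
    rw [← crossParity_eq_sum_boundary hJ.1 S]
    rfl
  have h0 : (1 : ZMod 2) + 1 = 0 := CharTwo.add_self_eq_zero 1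
  have hboth : Even (S ∩ {s, t}).card → Odd (cut S ∩ J).card → 1 ≤ ∑ e ∈ cut S, y e := by
    intro heven hodd
    obtain ⟨e, he⟩ := Finset.card_pos.1 hodd.pos
    obtain ⟨a, b, ha, hb, -⟩ := exists_of_mem_cut (Finset.mem_inter.1 he).1
    have h3 := hx.even_cut S ⟨a, ha⟩ (by rintro rfl; exact hb (Finset.mem_univ b)) heven
    have h4 : (1 : ℝ) ≤ (cut S ∩ J).card := by exact_mod_cast hodd.pos
    have h5 := mul_le_mul_of_nonneg_left h3 hβ
    have h6 := mul_le_mul_of_nonneg_left h4 hα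
    have h7 := Finset.sum_nonneg fun e (_ : e ∈ cut S) => hcorr e
    rw [hysum]
    linarith
  by_cases hs : s ∈ S <;> by_cases ht : t ∈ S
  · refine hboth (by rw [card_inter_pair hst]; simp [hs, ht]) ?_
    rw [← zmod_two_natCast_eq_one]
    simpa [hs, ht, h0] using hpar
  · refine hsep S hs ht ?_
    rw [← zmod_two_natCast_eq_zero]
    simpa [hs, ht] using hpar
  -- Narrow cuts are recorded on the side of `s`, so pass to the complement.
  · rw [← cut_compl]
    refine hsep Sᶜ (by simpa using hs) (by simpa using ht) ?_
    rw [cut_compl, ← zmod_two_natCast_eq_zero]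
    simpa [hs, ht] using hpar
  · refine hboth (by rw [card_inter_pair hst]; simp [hs, ht]) ?_
    rw [← zmod_two_natCast_eq_one]
    simpa [hs, ht] using hpar

/-- The correction is linear in the number of crossings of each narrow cut, so its expectation
depends only on `x` and not on the decomposition. -/
lemma expectation_correction_le {x : Sym2 V → ℝ} (D : TreeDecomposition x)
    {α β τ : ℝ} (hβ : 0 ≤ β) {𝒩 : Finset (Finset V)} {f : 𝒩 → Sym2 V → ℝ}
    (hf : ∀ U e, 0 ≤ f U e) {e : Sym2 V} (he : e ∈ edges V) (hfe : ∑ U, f U e ≤ x e) :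
    ∑ i, D.coeff i * ((if e ∈ D.tree i then 1 else 0) + (α * (if e ∈ D.tree i then 1 else 0) +
      β * x e + ∑ U : 𝒩, ((cut U.1 ∩ D.tree i).card - 1) *
        (β * (τ - ∑ e ∈ cut U.1, x e)) * f U e)) ≤
      (1 + α + β + β * ((τ - 1) / 2) ^ 2) * x e := by
  have h1 : ∑ i, D.coeff i * ((if e ∈ D.tree i then 1 else 0) +
      (α * (if e ∈ D.tree i then 1 else 0) + β * x e +
        ∑ U : 𝒩, ((cut U.1 ∩ D.tree i).card - 1) *
          (β * (τ - ∑ e ∈ cut U.1, x e)) * f U e)) =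
      (1 + α) * x e + β * x e + ∑ U : 𝒩, (∑ e ∈ cut U.1, x e - 1) *
        (β * (τ - ∑ e ∈ cut U.1, x e)) * f U e := by
    have h2 : ∀ U : 𝒩, (∑ e ∈ cut U.1, x e - 1) * (β * (τ - ∑ e ∈ cut U.1, x e)) * f U e =
        ∑ i, D.coeff i * (((cut U.1 ∩ D.tree i).card - 1) *
          (β * (τ - ∑ e ∈ cut U.1, x e)) * f U e) := by
      intro U
      have h3 : ∑ e ∈ cut U.1, x e - 1 = ∑ i, D.coeff i * ((cut U.1 ∩ D.tree i).card - 1 : ℝ) := by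
        simp only [mul_sub, mul_one, Finset.sum_sub_distrib]
        rw [D.expectation_card_cut, D.sum_coeff]
      rw [h3, Finset.sum_mul, Finset.sum_mul]
      exact Finset.sum_congr rfl fun i _ => by ring
    rw [Finset.sum_congr rfl fun U _ => h2 U, Finset.sum_comm]
    have h4 : (1 + α) * x e + β * x e =
        ∑ i, (D.coeff i * ((1 + α) * (if e ∈ D.tree i then 1 else 0)) + D.coeff i * (β * x e)) := by
      rw [Finset.sum_add_distrib, ← Finset.sum_mul, D.sum_coeff, one_mul]
      nth_rewrite 1 [← D.sum_eq e he]
      rw [Finset.mul_sum]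
      congr 1
      exact Finset.sum_congr rfl fun i _ => by ring
    rw [h4, ← Finset.sum_add_distrib]
    refine Finset.sum_congr rfl fun i _ => ?_
    rw [← Finset.mul_sum]
    ring
  rw [h1]
  have h2 : ∑ U : 𝒩, (∑ e ∈ cut U.1, x e - 1) * (β * (τ - ∑ e ∈ cut U.1, x e)) * f U e ≤
      β * ((τ - 1) / 2) ^ 2 * x e := by
    calc _ ≤ ∑ U : 𝒩, β * ((τ - 1) / 2) ^ 2 * f U e := by
          refine Finset.sum_le_sum fun U _ => mul_le_mul_of_nonneg_right ?_ (hf U e)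
          -- Completing the square: (z - 1)(τ - z) = ((τ - 1)/2)² - (z - (τ + 1)/2)².
          have : 0 ≤ β * (∑ e ∈ cut U.1, x e - (τ + 1) / 2) ^ 2 := by positivity
          linarith
      _ = β * ((τ - 1) / 2) ^ 2 * ∑ U, f U e := (Finset.mul_sum _ _ _).symm
      _ ≤ _ := by gcongr
  linarith

/-- The analysis of An, Kleinberg and Shmoys. -/
theorem expectation_walkCost_le {s t : V} (hst : s ≠ t) {c : Sym2 V → ℝ} (hc : IsMetricCost c)
    {x : Sym2 V → ℝ} (hx : LPFeasible s t x) (D : TreeDecomposition x)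
    (F : Fin D.size → Finset (Sym2 V)) (w p : Fin D.size → (⊤ : SimpleGraph V).Walk s t)
    (h : ∀ i, IsMinTJoin c (wrongDegree s t (D.tree i)) (F i) ∧
      IsEulerianTraversal (D.tree i) (F i) (w i) ∧ IsShortcut (w i) (p i)) :
    D.expectation (fun i => walkCost c (p i)) ≤ (1 + Real.sqrt 5) / 2 * lpCost c x := by
  classical
  have h5 : Real.sqrt 5 ^ 2 = 5 := Real.sq_sqrt (by norm_num)
  have h5lt : Real.sqrt 5 < 5 / 2 := by
    rw [Real.sqrt_lt' (by norm_num)]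
    norm_num
  have h5gt : 2 < Real.sqrt 5 := by
    rw [Real.lt_sqrt (by norm_num)]
    norm_num
  -- The two constraints give α = 1 - 2β and τ = 4 - 1/β, and the factor becomes 1/2 + (5β + 1/β)/4,
  -- which is least at β = 1/√5.
  let β : ℝ := Real.sqrt 5 / 5
  let α : ℝ := 1 - 2 * β
  let τ : ℝ := 4 - Real.sqrt 5
  have hβ : 0 ≤ β := by positivity
  have hα : 0 ≤ α := by simp only [α, β]; linarith
  have h1 : α + 2 * β = 1 := by simp only [α]; ring
  have h2 : 2 * α + β * τ = 1 := by simp only [α, β, τ]; linear_combination (-1 / 5) * h5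
  let 𝒩 : Finset (Finset V) := Finset.univ.filter fun U => s ∈ U ∧ t ∉ U ∧ ∑ e ∈ cut U, x e < τ
  have h𝒩 : ∀ U, U ∈ 𝒩 ↔ s ∈ U ∧ t ∉ U ∧ ∑ e ∈ cut U, x e < τ := by simp [𝒩]
  have hτ : τ ≤ 2 := by simp only [τ]; linarith
  obtain ⟨f, hf, hfx, hf1⟩ := exists_narrow_assignment hx 𝒩
    (fun U hU => ⟨((h𝒩 U).1 hU).1, ((h𝒩 U).1 hU).2.1⟩) (fun U hU U' hU' =>
      narrow_chain hx ⟨((h𝒩 U).1 hU).1, ((h𝒩 U).1 hU).2.1⟩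
        ⟨((h𝒩 U').1 hU').1, ((h𝒩 U').1 hU').2.1⟩ (((h𝒩 U).1 hU).2.2.trans_le hτ)
        (((h𝒩 U').1 hU').2.2.trans_le hτ))
  let y : Fin D.size → Sym2 V → ℝ := fun i e => α * (if e ∈ D.tree i then 1 else 0) + β * x e +
      ∑ U : 𝒩, ((cut U.1 ∩ D.tree i).card - 1) * (β * (τ - ∑ e ∈ cut U.1, x e)) * f U e
  have hi : ∀ i, walkCost c (p i) ≤
      ∑ e ∈ edges V, c e * ((if e ∈ D.tree i then 1 else 0) + y i e) := by
    intro i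
    obtain ⟨hF, hw, hp⟩ := h i
    have hJ := D.isSpanningTree i
    obtain ⟨hy0, hy1⟩ := correction_covers hst hx hα hβ h1 h2 h𝒩 hf hf1 hJ
      (fun U => rfl) (y := y i) fun e => rfl
    rw [isMinTJoin_wrongDegree_iff hst] at hF
    obtain ⟨F', hF'E, hF'b, hF'⟩ := exists_join_cost_le hc.nonneg hy0
      (exists_boundary_eq hst hJ.1) hy1
    have h3 := hF.le F' hF'E hF'b
    have h4 := walkCost_le_of_isShortcut hc hp
    rw [walkCost_eq_of_isEulerianTraversal c hw] at h4
    have h6 := sum_indicator_mul hJ.1 c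
    simp only [mul_add, Finset.sum_add_distrib]
    simp only [mul_comm (c _) (if _ then _ else _), h6]
    linarith
  have hconst : 1 + α + β + β * ((τ - 1) / 2) ^ 2 = (1 + Real.sqrt 5) / 2 := by
    simp only [α, β, τ]
    linear_combination (Real.sqrt 5 / 20 - 3 / 10) * h5
  calc D.expectation (fun i => walkCost c (p i))
      ≤ ∑ i, D.coeff i * ∑ e ∈ edges V, c e * ((if e ∈ D.tree i then 1 else 0) + y i e) :=
        Finset.sum_le_sum fun i _ => mul_le_mul_of_nonneg_left (hi i) (D.coeff_pos i).le
    _ = ∑ e ∈ edges V, c e * ∑ i, D.coeff i * ((if e ∈ D.tree i then 1 else 0) + y i e) := by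
        simp only [Finset.mul_sum]
        rw [Finset.sum_comm]
        exact Finset.sum_congr rfl fun e _ => Finset.sum_congr rfl fun i _ => by ring
    _ ≤ ∑ e ∈ edges V, c e * ((1 + Real.sqrt 5) / 2 * x e) := by
        refine Finset.sum_le_sum fun e he => mul_le_mul_of_nonneg_left ?_ (hc.nonneg e he)
        rw [← hconst]
        exact expectation_correction_le D hβ hf he (hfx e he)
    _ = (1 + Real.sqrt 5) / 2 * lpCost c x := by
        rw [lpCost, Finset.mul_sum]
        exact Finset.sum_congr rfl fun e _ => by ring

end PathTSP

theorem mainTheorem2 {V : Type*} [Fintype V] [DecidableEq V] (s t : V) (hst : s ≠ t)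
    (c : Sym2 V → ℝ) (hc : PathTSP.IsMetricCost c) :
    -- the relaxation has an optimal solution
    (∃ x, PathTSP.IsLPOptimal c s t x) ∧
    -- whichever optimal solution is found
    ∀ x, PathTSP.IsLPOptimal c s t x →
      -- it has a convex decomposition into spanning trees, and whichever decomposition is found
      Nonempty (PathTSP.TreeDecomposition x) ∧
      ∀ D : PathTSP.TreeDecomposition x,
        -- for each tree that may be sampled, the remaining steps can be carried out
        (∀ i,
          (∃ F, PathTSP.IsMinTJoin c (PathTSP.wrongDegree s t (D.tree i)) F) ∧
          ∀ F, PathTSP.IsMinTJoin c (PathTSP.wrongDegree s t (D.tree i)) F →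
            (∃ w : (⊤ : SimpleGraph V).Walk s t,
              PathTSP.IsEulerianTraversal (D.tree i) F w) ∧
            ∀ w : (⊤ : SimpleGraph V).Walk s t, PathTSP.IsEulerianTraversal (D.tree i) F w →
              ∃ p : (⊤ : SimpleGraph V).Walk s t, PathTSP.IsShortcut w p) ∧
        -- and however they are carried out, the expected cost of the output path `p i`
        -- is at most the factor times the optimal value
        ∀ (F : Fin D.size → Finset (Sym2 V))
          (w p : Fin D.size → (⊤ : SimpleGraph V).Walk s t),
          (∀ i, PathTSP.IsMinTJoin c (PathTSP.wrongDegree s t (D.tree i)) (F i) ∧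
            PathTSP.IsEulerianTraversal (D.tree i) (F i) (w i) ∧
            PathTSP.IsShortcut (w i) (p i)) →
          D.expectation (fun i => PathTSP.walkCost c (p i)) ≤
              (1 + Real.sqrt 5) / 2 * PathTSP.lpCost c x ∧
          ∀ q : (⊤ : SimpleGraph V).Walk s t, q.IsHamiltonian →
            D.expectation (fun i => PathTSP.walkCost c (p i)) ≤
              (1 + Real.sqrt 5) / 2 * PathTSP.walkCost c q := by
  refine ⟨PathTSP.exists_isLPOptimal hst c, fun x hx =>
    ⟨hx.1.nonempty_treeDecomposition hst, fun D => ⟨fun i => ?_, fun F w p h => ?_⟩⟩⟩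
  · have hJ := D.isSpanningTree i
    refine ⟨PathTSP.exists_isMinTJoin hst c hJ.1, fun F hF => ?_⟩
    exact ⟨PathTSP.exists_isEulerianTraversal hst hJ hF.1, fun w hw =>
      PathTSP.exists_isShortcut hst w (hw.mem_support hst hJ)⟩
  · have hle := PathTSP.expectation_walkCost_le hst hc hx.1 D F w p h
    refine ⟨hle, fun q hq => hle.trans (mul_le_mul_of_nonneg_left ?_ (by positivity))⟩
    rw [← PathTSP.lpCost_hamiltonian c hq]
    exact hx.2 _ (PathTSP.lpFeasible_of_isHamiltonian hst hq)
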